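/- Let $d \ge 1$ and let $J=J_{a,b}$ be the bounded Jacobi operator on $\ell^2(\mathbb{Z}^d)$, \[ (Ju)_x = \sum_{y \in \mathbb{Z}^d,\ \|x-y\|_1=1} a_{x,y}\,u_y + b_x u_x, \] where $a$ (complex) and $b$ (real-valued) are bounded and $a_{y,x} = \overline{a_{x,y}} \neq 0$ whenever $\|x-y\|_1 = 1$. Assume that $J$ is periodic: there is a full-rank subgroup $\mathbb{L} \subseteq \mathbb{Z}^d$ such that $U^{\ell} J U^{-\ell} = J$ for all $\ell \in \mathbb{L}$, where $U^\ell$ is the shift $\delta_x \mapsto \delta_{x+\ell}$. For $1 \le k \le d$ let $X_k$ be the position operator $(X_k\psi)_x = x_k\psi_x$ with domain $D(X_k) = \{\psi \in \ell^2(\mathbb{Z}^d) : X_k\psi \in \ell^2(\mathbb{Z}^d)\}$, and let $X\psi = (X_1\psi,\dots,X_d\psi) \in \ell^2(\mathbb{Z}^d)\otimes\mathbb{C}^d$ with domain $D(X) = \bigcap_k D(X_k)$. Put $X_k(t) = e^{itJ}X_k e^{-itJ}$ and $X(t) = e^{itJ}Xe^{-itJ} = (X_1(t),\dots,X_d(t))$,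 on their natural domains. Then there are bounded self-adjoint operators $Q_1,\dots,Q_d$ on $\ell^2(\mathbb{Z}^d)$ such that, for every $k$, $D(X_k(t)) = D(X_k)$ for all $t \in \mathbb{R}$, \[ \lim_{t\to\infty} \frac{X_k(t)\psi}{t} = Q_k\psi \quad\text{in norm, for every } \psi \in D(X_k), \] and $\ker Q_k = \{0\}$. In particular, there is a bounded operator $Q : \ell^2(\mathbb{Z}^d) \to \ell^2(\mathbb{Z}^d)\otimes\mathbb{C}^d$ with $D(X(t)) = D(X)$ for all $t\in\mathbb{R}$, $\lim_{t\to\infty} X(t)\psi/t = Q\psi$ in norm for every $\psi \in D(X)$, and $\ker Q = \{0\}$. -/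

import Mathlib

noncomputable section

/-- The Hilbert space `ℓ²(ℤ^d)` of square-summable complex functions on `ℤ^d`. -/
abbrev EllTwo (d : ℕ) : Type := lp (fun _ : Fin d → ℤ => ℂ) 2

/-- Nearest neighbours in `ℤ^d`: `x ∼ y` means `‖x - y‖₁ = 1`. -/
def Nbr {d : ℕ} (x y : Fin d → ℤ) : Prop := ∑ j, |x j - y j| = 1

instance {d : ℕ} (x y : Fin d → ℤ) : Decidable (Nbr x y) :=
  inferInstanceAs (Decidable (_ = _))

/-- The finite set of nearest neighbours of `x`. -/
def nbrs {d : ℕ} (x : Fin d → ℤ) : Finset (Fin d → ℤ) :=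
  (Finset.Icc (x - 1) (x + 1)).filter (fun y => Nbr x y)

theorem mem_nbrs {d : ℕ} {x y : Fin d → ℤ} : y ∈ nbrs x ↔ Nbr x y := by
  simp only [nbrs, Finset.mem_filter, and_iff_right_iff_imp]
  intro h
  have key : ∀ j, |x j - y j| ≤ 1 := fun j =>
    (Finset.single_le_sum (f := fun j => |x j - y j|) (fun i _ => abs_nonneg _)
      (Finset.mem_univ j)).trans h.le
  rw [Finset.mem_Icc]
  constructor <;> intro j <;> have := abs_le.1 (key j) <;> simp <;> omega

/-- The coefficients of a Jacobi operator on `ℤ^d`: bounded, nonzero hoppings `a x y` along the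
edges `x ∼ y` with `a y x = conj (a x y)`, and a bounded real diagonal `b`. (The values `a x y` for
`x ≁ y` play no role.) -/
structure JacobiCoeff (d : ℕ) where
  /-- the hoppings -/
  a : (Fin d → ℤ) → (Fin d → ℤ) → ℂ
  /-- the diagonal -/
  b : (Fin d → ℤ) → ℝ
  bounded_a : ∃ C : ℝ, ∀ x y, Nbr x y → ‖a x y‖ ≤ C
  bounded_b : ∃ C : ℝ, ∀ x, |b x| ≤ C
  conj_symm : ∀ x y, Nbr x y → a y x = starRingEnd ℂ (a x y)
  ne_zero : ∀ x y, Nbr x y → a x y ≠ 0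

namespace EllTwo

variable {d : ℕ}

theorem mem_iff (f : (Fin d → ℤ) → ℂ) : Memℓp f 2 ↔ Summable fun x => ‖f x‖ ^ 2 := by
  rw [memℓp_gen_iff (by norm_num)]
  simp

theorem norm_sq (u : EllTwo d) : ‖u‖ ^ 2 = ∑' x, ‖u x‖ ^ 2 := by
  have := lp.norm_rpow_eq_tsum (p := 2) (by norm_num) u
  simpa using this

theorem mem_translate (v : Fin d → ℤ) (u : EllTwo d) :
    Memℓp (fun x => u (x - v) : (Fin d → ℤ) → ℂ) 2 := by
  rw [mem_iff]
  exact ((Equiv.subRight v).summable_iff (f := fun x => ‖u x‖ ^ 2)).2 ((mem_iff _).1 u.2)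

/-- The shift `U^v`, the unitary with `U^v δ_x = δ_{x+v}`, that is `(U^v u)(x) = u(x - v)`. -/
def shift (v : Fin d → ℤ) : EllTwo d →L[ℂ] EllTwo d :=
  LinearMap.mkContinuous
    { toFun := fun u => ⟨fun x => u (x - v), mem_translate v u⟩
      map_add' := fun _ _ => rfl
      map_smul' := fun _ _ => rfl }
    1 (by
      intro u
      refine (sq_le_sq₀ (norm_nonneg _) (by positivity)).1 ?_
      rw [one_mul, norm_sq, norm_sq]
      exact ((Equiv.subRight v).tsum_eq (fun x => ‖u x‖ ^ 2)).le)

theorem shift_apply (v : Fin d → ℤ) (u : EllTwo d) (x : Fin d → ℤ) :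
    shift v u x = u (x - v) := rfl

theorem mem_mul {c : (Fin d → ℤ) → ℂ} {C : ℝ} (hc : ∀ x, ‖c x‖ ≤ C) (u : EllTwo d) :
    Memℓp (fun x => c x * u x : (Fin d → ℤ) → ℂ) 2 := by
  rw [mem_iff]
  refine Summable.of_nonneg_of_le (fun _ => by positivity) (fun x => ?_)
    (((mem_iff _).1 u.2).mul_left (C ^ 2))
  rw [norm_mul, mul_pow]
  gcongr
  exact hc x

/-- Multiplication by a bounded function. -/
def mulOp (c : (Fin d → ℤ) → ℂ) (C : ℝ) (hc : ∀ x, ‖c x‖ ≤ C) : EllTwo d →L[ℂ] EllTwo d :=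
  LinearMap.mkContinuous
    { toFun := fun u => ⟨fun x => c x * u x, mem_mul hc u⟩
      map_add' := fun u w => lp.ext (funext fun x => mul_add (c x) (u x) (w x))
      map_smul' := fun r u => lp.ext (funext fun x => mul_left_comm (c x) r (u x)) }
    C (by
      intro u
      have hC : 0 ≤ C := (norm_nonneg _).trans (hc 0)
      refine (sq_le_sq₀ (norm_nonneg _) (by positivity)).1 ?_
      rw [mul_pow, norm_sq, norm_sq, ← tsum_mul_left]
      refine Summable.tsum_le_tsum (fun x => ?_) ((mem_iff _).1 (mem_mul hc u))
        (((mem_iff _).1 u.2).mul_left (C ^ 2))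
      change ‖c x * u x‖ ^ 2 ≤ _
      rw [norm_mul, mul_pow]
      gcongr
      exact hc x)

theorem mulOp_apply (c : (Fin d → ℤ) → ℂ) (C : ℝ) (hc : ∀ x, ‖c x‖ ≤ C) (u : EllTwo d)
    (x : Fin d → ℤ) : mulOp c C hc u x = c x * u x := rfl

end EllTwo

namespace JacobiCoeff

variable {d : ℕ} (A : JacobiCoeff d)

theorem sum_nbrs (x : Fin d → ℤ) (f : (Fin d → ℤ) → ℂ) :
    ∑ y ∈ nbrs x, f y = ∑ v ∈ nbrs (0 : Fin d → ℤ), f (x - v) := by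
  refine Finset.sum_bij' (fun y _ => x - y) (fun v _ => x - v) ?_ ?_ ?_ ?_ ?_
  · intro y hy
    rw [mem_nbrs] at hy ⊢
    simpa [Nbr, abs_sub_comm] using hy
  · intro y hy
    rw [mem_nbrs] at hy ⊢
    simpa [Nbr] using hy
  all_goals simp

/-- The formula defining `J` is given by some bounded operator; this is what makes
the definition of `JacobiCoeff.op` below possible. -/
theorem exists_op : ∃ K : EllTwo d →L[ℂ] EllTwo d, ∀ u x,
    K u x = ∑ y ∈ nbrs x, A.a x y * u y + (A.b x : ℂ) * u x := by
  obtain ⟨C, hC⟩ := A.bounded_a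
  obtain ⟨B, hB⟩ := A.bounded_b
  have hC' : ∀ v ∈ nbrs (0 : Fin d → ℤ), ∀ x, ‖A.a x (x - v)‖ ≤ C := by
    intro v hv x
    refine hC _ _ ?_
    rw [mem_nbrs] at hv
    simpa [Nbr] using hv
  refine ⟨∑ v ∈ (nbrs (0 : Fin d → ℤ)).attach,
      (EllTwo.mulOp (fun x => A.a x (x - v)) C (hC' v.1 v.2)).comp (EllTwo.shift v.1)
      + EllTwo.mulOp (fun x => (A.b x : ℂ)) B (by simpa using hB), fun u x => ?_⟩
  rw [sum_nbrs, ← Finset.sum_attach (nbrs (0 : Fin d → ℤ)), add_apply, lp.coeFn_add,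
    Pi.add_apply, EllTwo.mulOp_apply, sum_apply, lp.coeFn_sum, Finset.sum_apply]
  rfl

/-- The Jacobi operator `J = J_{a,b}` on `ℓ²(ℤ^d)`,
`(J u)(x) = ∑_{y ∼ x} a_{x,y} u(y) + b_x u(x)`. -/
def op : EllTwo d →L[ℂ] EllTwo d :=
  LinearMap.mkContinuousOfExistsBound
    { toFun := fun u =>
        ⟨fun x => ∑ y ∈ nbrs x, A.a x y * u y + (A.b x : ℂ) * u x, by
          obtain ⟨K, hK⟩ := A.exists_op
          have h : (fun x => ∑ y ∈ nbrs x, A.a x y * u y + (A.b x : ℂ) * u x) = ⇑(K u) :=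
            funext fun x => (hK u x).symm
          exact h ▸ (K u).2⟩
      map_add' := fun u w => lp.ext (funext fun x => by
        simp only [lp.coeFn_add, Pi.add_apply, mul_add, Finset.sum_add_distrib]
        ring)
      map_smul' := fun r u => lp.ext (funext fun x => by
        simp only [lp.coeFn_smul, Pi.smul_apply, smul_eq_mul, mul_add, Finset.mul_sum,
          RingHom.id_apply, mul_left_comm r]) }
    (by
      obtain ⟨K, hK⟩ := A.exists_op
      refine ⟨‖K‖, fun u => ?_⟩
      refine le_of_eq_of_le (congrArg norm ?_) (K.le_opNorm u)
      exact lp.ext (funext fun x => (hK u x).symm))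

theorem op_apply (u : EllTwo d) (x : Fin d → ℤ) :
    A.op u x = ∑ y ∈ nbrs x, A.a x y * u y + (A.b x : ℂ) * u x := rfl

/-- `J` is periodic: there is a full-rank subgroup `L ⊆ ℤ^d` such that `U^ℓ J U^{-ℓ} = J` for all
`ℓ ∈ L`. -/
def IsPeriodic : Prop :=
  ∃ L : AddSubgroup (Fin d → ℤ), Module.finrank ℤ L = d ∧
    ∀ l ∈ L, EllTwo.shift l ∘L A.op ∘L EllTwo.shift (-l) = A.op

/-- The unitary `e^{itJ}`, through the exponential series in the algebra of bounded operators. -/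
def evol (t : ℝ) : EllTwo d →L[ℂ] EllTwo d :=
  NormedSpace.exp (((t : ℂ) * Complex.I) • A.op)

end JacobiCoeff

/-- The `k`-th position operator on its maximal domain: `(X_k ψ)(x) = x_k ψ(x)` for those
`ψ ∈ ℓ²(ℤ^d)` for which this is again in `ℓ²(ℤ^d)`. -/
def posOp {d : ℕ} (k : Fin d) : EllTwo d →ₗ.[ℂ] EllTwo d where
  domain :=
    { carrier := {ψ | Memℓp (fun x => (x k : ℂ) * ψ x : (Fin d → ℤ) → ℂ) 2}
      add_mem' := fun {ψ φ} hψ hφ => by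
        have h : (fun x => (x k : ℂ) * (ψ + φ) x : (Fin d → ℤ) → ℂ) =
            (fun x => (x k : ℂ) * ψ x) + fun x => (x k : ℂ) * φ x :=
          funext fun x => mul_add _ (ψ x) (φ x)
        exact (congrArg (fun f => Memℓp f 2) h).mpr (Memℓp.add hψ hφ)
      zero_mem' := by
        have h : (fun x => (x k : ℂ) * (0 : EllTwo d) x : (Fin d → ℤ) → ℂ) = 0 :=
          funext fun x => mul_zero _
        exact (congrArg (fun f => Memℓp f 2) h).mpr zero_memℓp
      smul_mem' := fun c ψ hψ => by
        have h : (fun x => (x k : ℂ) * (c • ψ) x : (Fin d → ℤ) → ℂ) =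
            c • fun x => (x k : ℂ) * ψ x :=
          funext fun x => mul_left_comm _ c (ψ x)
        exact (congrArg (fun f => Memℓp f 2) h).mpr (Memℓp.const_smul hψ c) }
  toFun :=
    { toFun := fun ψ => ⟨fun x => (x k : ℂ) * ψ.1 x, ψ.2⟩
      map_add' := fun ψ φ => lp.ext (funext fun x => mul_add _ (ψ.1 x) (φ.1 x))
      map_smul' := fun c ψ => lp.ext (funext fun x => mul_left_comm _ c (ψ.1 x)) }

/-- The Hilbert space `ℓ²(ℤ^d) ⊗ ℂ^d`, as `d`-tuples of elements of `ℓ²(ℤ^d)`. -/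
abbrev EllTwoVec (d : ℕ) : Type := PiLp 2 (fun _ : Fin d => EllTwo d)

/-- The vector position operator `X ψ = (X_1 ψ, …, X_d ψ)` with domain `⋂ k, D(X_k)`. -/
def vecPosOp (d : ℕ) : EllTwo d →ₗ.[ℂ] EllTwoVec d where
  domain := ⨅ k, (posOp k).domain
  toFun :=
    { toFun := fun ψ => WithLp.toLp 2 fun k => posOp k ⟨ψ.1, (Submodule.mem_iInf _).1 ψ.2 k⟩
      map_add' := fun ψ φ => by
        ext k : 1
        exact (posOp k).map_add ⟨ψ.1, (Submodule.mem_iInf _).1 ψ.2 k⟩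
          ⟨φ.1, (Submodule.mem_iInf _).1 φ.2 k⟩
      map_smul' := fun c ψ => by
        ext k : 1
        exact (posOp k).map_smul c ⟨ψ.1, (Submodule.mem_iInf _).1 ψ.2 k⟩ }

/-- The operator `B ⊗ 1` on `ℓ²(ℤ^d) ⊗ ℂ^d`, which applies `B` to each component. -/
def ampl {d : ℕ} (B : EllTwo d →L[ℂ] EllTwo d) : EllTwoVec d →ₗ[ℂ] EllTwoVec d where
  toFun := fun Ψ => WithLp.toLp 2 fun k => B (Ψ k)
  map_add' := fun Ψ Φ => by
    ext k : 1
    exact B.map_add (Ψ k) (Φ k)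
  map_smul' := fun c Ψ => by
    ext k : 1
    exact B.map_smul c (Ψ k)

/-- The product `V T W` of a partially defined operator `T` with everywhere defined operators, on
its natural domain `{ψ | W ψ ∈ D(T)}`. -/
def sandwich {E F : Type*} [AddCommGroup E] [Module ℂ E] [AddCommGroup F] [Module ℂ F]
    (V : F →ₗ[ℂ] F) (T : E →ₗ.[ℂ] F) (W : E →ₗ[ℂ] E) : E →ₗ.[ℂ] F where
  domain := T.domain.comap W
  toFun :=
    { toFun := fun ψ => V (T ⟨W ψ.1, ψ.2⟩)
      map_add' := fun ψ φ => by
        rw [← V.map_add, ← T.map_add]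
        congr 2
        exact Subtype.ext (W.map_add ψ.1 φ.1)
      map_smul' := fun c ψ => by
        rw [RingHom.id_apply, ← V.map_smul, ← T.map_smul]
        congr 2
        exact Subtype.ext (W.map_smul c ψ.1) }

namespace JacobiCoeff

variable {d : ℕ} (A : JacobiCoeff d)

/-- `X_k(t) = e^{itJ} X_k e^{-itJ}`. -/
def posOpAt (k : Fin d) (t : ℝ) : EllTwo d →ₗ.[ℂ] EllTwo d :=
  sandwich (A.evol t).toLinearMap (posOp k) (A.evol (-t)).toLinearMap

/-- `X(t) = e^{itJ} X e^{-itJ}`, where the left factor acts on each component. -/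
def vecPosOpAt (t : ℝ) : EllTwo d →ₗ.[ℂ] EllTwoVec d :=
  sandwich (ampl (A.evol t)) (vecPosOp d) (A.evol (-t)).toLinearMap

end JacobiCoeff

/-- Strong convergence, as `t → ∞`, of a family of (possibly unbounded) operators `T t`
with common domain `D` to an everywhere defined bounded operator `Q`: each `T t` has domain `D`,
and `T t ψ → Q ψ` in norm for every `ψ ∈ D`. -/
def StrongLim {E F : Type*} [NormedAddCommGroup E] [NormedSpace ℂ E] [NormedAddCommGroup F]
    [NormedSpace ℂ F] (T : ℝ → E →ₗ.[ℂ] F) (D : Submodule ℂ E) (Q : E →L[ℂ] F) : Prop :=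
  ∃ h : ∀ t, D = (T t).domain, ∀ ψ : D,
    Filter.Tendsto (fun t : ℝ => T t ⟨ψ.1, h t ▸ ψ.2⟩) Filter.atTop (nhds (Q ψ.1))

end

/-! Write `X_k(t) = X_k + G(t)`. The displacement `G(t)` is bounded, self-adjoint and periodic, with
derivative `e^{itJ}(-i[X_k,J])e^{-itJ}` (`exists_displacement`). Since `X_k ψ / t → 0` on the
domain, the claim is that `G(t)/t` converges strongly to an injective operator.

Convergence: the cocycle identity `displacement_add` makes `G(N)/N` an average of the conjugates of
`G(1)` by powers of `e^{iJ}`. Periodic kernels that are square summable per cell form a Hilbert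
space on which this conjugation is a contraction, so von Neumann's mean ergodic theorem gives
convergence on each `δ_x` (`exists_tendsto_average`). Boundedness extends it to all vectors and all
real times (`exists_asymptotic_velocity`).

Injectivity: for commuting periods, `J` is integral over the Laurent ring `ℂ[z^{±1}]` acting by
shifts along `n ℤ^d`. Let `D = z_k ∂_k` act on the coefficients of polynomials over this ring. The
time average `V = iQ_k` of `[X_k,J]` commutes with `J`, so averaging `[X_k, r(J)]` gives `n (Dr)(J)
+ r'(J) V`. If `r(J) = 0` this vanishes, and `(Dr)(J)` kills `ker Q_k`
(`evalOp_polyLogDeriv_apply_eq_zero`). It remains to find `r` with `(Dr)(J)` injective. By counting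
dimensions in large boxes, injectivity on finitely supported functions is enough
(`injective_of_finite_support`).

Take `r ≠ 0` of minimal degree with `r(J) = 0`. A finitely supported failure of injectivity
produces, by pseudo-division, a factor `p` of `r` with `p(J)w = 0` for some finitely supported `w ≠
0`, whose coefficients have ratios killed by `D` (`eq_zero_of_evalOp_polyLogDeriv`); morally, a band
independent of the `k`-th quasimomentum. This is impossible: `J` moves the topmost point of a
support by exactly `e_k`, so the highest power of `J` in `p(J)w` cannot be cancelled
(`evalOp_apply_ne_zero_of_polyLogDeriv`). -/

noncomputable section

/-! ### Basis vectors, shifts and adjoints. -/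

namespace EllTwo

variable {d : ℕ}

/-- The basis vector `δ_x` of `ℓ²(ℤ^d)`. -/
def delta (x : Fin d → ℤ) : EllTwo d := lp.single 2 x (1 : ℂ)

theorem delta_apply (x y : Fin d → ℤ) : delta x y = if y = x then (1 : ℂ) else 0 := by
  rw [delta, lp.single_apply, Pi.single_apply]

theorem inner_delta_left (x : Fin d → ℤ) (u : EllTwo d) : inner ℂ (delta x) u = u x := by
  rw [delta, lp.inner_single_left]
  simp

theorem inner_delta_right (x : Fin d → ℤ) (u : EllTwo d) :
    inner ℂ u (delta x) = starRingEnd ℂ (u x) := by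
  rw [← inner_conj_symm, inner_delta_left]

theorem hasSum_delta (u : EllTwo d) : HasSum (fun x => (u x : ℂ) • delta x) u := by
  convert lp.hasSum_single (by norm_num) u using 2 with x
  rw [delta, ← lp.single_smul]
  simp

theorem mem_of_delta_mem {S : Submodule ℂ (EllTwo d)} (hS : IsClosed (S : Set (EllTwo d)))
    (h : ∀ x, delta x ∈ S) (u : EllTwo d) : u ∈ S :=
  hS.mem_of_tendsto (hasSum_delta u)
    (Filter.Eventually.of_forall fun _ => S.sum_mem fun x _ => S.smul_mem _ (h x))

theorem clm_ext {F : Type*} [NormedAddCommGroup F] [NormedSpace ℂ F] {S T : EllTwo d →L[ℂ] F}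
    (h : ∀ x, S (delta x) = T (delta x)) : S = T := by
  ext1 u
  refine (hasSum_delta u).mapL S |>.unique ?_
  simpa only [map_smul, h] using (hasSum_delta u).mapL T

theorem shift_mul (v w : Fin d → ℤ) : shift v * shift w = shift (v + w) := by
  ext1 u
  refine lp.ext (funext fun x => ?_)
  simp only [mul_apply_eq_comp, shift_apply]
  abel_nf

theorem shift_zero : shift (0 : Fin d → ℤ) = 1 := by
  ext1 u
  refine lp.ext (funext fun x => ?_)
  simp [shift_apply]

theorem shift_neg_mul (v : Fin d → ℤ) : shift (-v) * shift v = 1 := by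
  rw [shift_mul, neg_add_cancel, shift_zero]

theorem shift_delta (v x : Fin d → ℤ) : shift v (delta x) = delta (x + v) := by
  refine lp.ext (funext fun y => ?_)
  rw [shift_apply, delta_apply, delta_apply]
  simp [sub_eq_iff_eq_add]

theorem norm_shift (v : Fin d → ℤ) (u : EllTwo d) : ‖shift v u‖ = ‖u‖ := by
  refine (sq_eq_sq₀ (norm_nonneg _) (norm_nonneg _)).1 ?_
  rw [norm_sq, norm_sq]
  exact (Equiv.subRight v).tsum_eq (fun x => ‖u x‖ ^ 2)

theorem adjoint_apply_delta (T : EllTwo d →L[ℂ] EllTwo d) (x y : Fin d → ℤ) :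
    star T (delta x) y = starRingEnd ℂ (T (delta y) x) := by
  rw [← inner_delta_left, ContinuousLinearMap.star_eq_adjoint,
    ContinuousLinearMap.adjoint_inner_right, inner_delta_right]

theorem star_shift (v : Fin d → ℤ) : star (shift v) = shift (-v) := by
  refine clm_ext fun x => lp.ext (funext fun y => ?_)
  rw [adjoint_apply_delta, shift_delta, shift_delta, delta_apply, delta_apply]
  have : x = y + v ↔ y = x + -v := ⟨fun h => by rw [h]; abel, fun h => by rw [h]; abel⟩
  simp only [this]
  split_ifs <;> simp

end EllTwo

theorem Nbr.symm {d : ℕ} {x y : Fin d → ℤ} (h : Nbr x y) : Nbr y x := by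
  simpa [Nbr, abs_sub_comm] using h

/-! ### The unitary group of `J` and its periods. -/

namespace JacobiCoeff

open EllTwo

variable {d : ℕ} (A : JacobiCoeff d)

theorem op_delta_apply (x y : Fin d → ℤ) : A.op (delta y) x =
    (if Nbr x y then A.a x y else 0) + if x = y then (A.b x : ℂ) else 0 := by
  rw [op_apply]
  congr 1
  · simp only [delta_apply, mul_ite, mul_one, mul_zero]
    rw [Finset.sum_ite_eq']
    simp only [mem_nbrs]
  · simp only [delta_apply, mul_ite, mul_one, mul_zero]

theorem star_op : star A.op = A.op := by
  refine clm_ext fun x => lp.ext (funext fun y => ?_)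
  rw [adjoint_apply_delta, op_delta_apply, op_delta_apply, map_add]
  congr 1
  · by_cases h : Nbr x y
    · rw [if_pos h, if_pos h.symm, A.conj_symm x y h]
    · rw [if_neg h, if_neg (fun h' => h h'.symm), map_zero]
  · by_cases h : x = y
    · rw [if_pos h, if_pos h.symm, h, Complex.conj_ofReal]
    · rw [if_neg h, if_neg (Ne.symm h), map_zero]

theorem evol_zero : A.evol 0 = 1 := by simp [evol]

theorem evol_add (s t : ℝ) : A.evol (s + t) = A.evol s * A.evol t := by
  let _ : NormedAlgebra ℚ (EllTwo d →L[ℂ] EllTwo d) := NormedAlgebra.restrictScalars ℚ ℂ _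
  rw [evol, evol, evol, ← NormedSpace.exp_add_of_commute]
  · congr 1
    rw [← add_smul]
    congr 1
    push_cast
    ring
  · exact (Commute.refl A.op).smul_left _ |>.smul_right _

theorem evol_mul_neg (t : ℝ) : A.evol t * A.evol (-t) = 1 := by
  rw [← evol_add, add_neg_cancel, evol_zero]

theorem evol_neg_mul (t : ℝ) : A.evol (-t) * A.evol t = 1 := by
  rw [← evol_add, neg_add_cancel, evol_zero]

theorem evol_nat (n : ℕ) : A.evol n = A.evol 1 ^ n := by
  induction n with
  | zero => simp [evol_zero]
  | succ m ih => rw [pow_succ, ← ih, ← evol_add]; push_cast; rfl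

theorem evol_neg_nat (n : ℕ) : A.evol (-n) = A.evol (-1) ^ n := by
  induction n with
  | zero => simp [evol_zero]
  | succ m ih => rw [pow_succ, ← ih, ← evol_add]; push_cast; congr 1; ring

theorem star_evol (t : ℝ) : star (A.evol t) = A.evol (-t) := by
  rw [evol, NormedSpace.star_exp, star_smul, star_op, evol]
  congr 2
  simp

theorem norm_evol_apply (t : ℝ) (u : EllTwo d) : ‖A.evol t u‖ = ‖u‖ := by
  have h : inner ℂ (A.evol t u) (A.evol t u) = inner ℂ u u := by
    rw [← ContinuousLinearMap.adjoint_inner_right, ← ContinuousLinearMap.star_eq_adjoint,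
      star_evol, ← mul_apply_eq_comp, evol_neg_mul, one_apply_eq_self]
  rw [inner_self_eq_norm_sq_to_K, inner_self_eq_norm_sq_to_K] at h
  exact (sq_eq_sq₀ (norm_nonneg _) (norm_nonneg _)).1 (by exact_mod_cast h)

theorem norm_evol_le (t : ℝ) : ‖A.evol t‖ ≤ 1 :=
  ContinuousLinearMap.opNorm_le_bound _ zero_le_one fun u => by rw [norm_evol_apply, one_mul]

theorem norm_conj_le (t : ℝ) (T : EllTwo d →L[ℂ] EllTwo d) :
    ‖A.evol t * T * A.evol (-t)‖ ≤ ‖T‖ := by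
  refine (norm_mul_le _ _).trans ?_
  refine (mul_le_of_le_one_right (norm_nonneg _) (A.norm_evol_le _)).trans ?_
  refine (norm_mul_le _ _).trans ?_
  exact mul_le_of_le_one_left (norm_nonneg _) (A.norm_evol_le _)

theorem evol_commute {T : EllTwo d →L[ℂ] EllTwo d} (h : Commute T A.op) (t : ℝ) :
    Commute T (A.evol t) :=
  (h.smul_right _).exp_right

theorem hasDerivAt_evol (t : ℝ) :
    HasDerivAt A.evol (Complex.I • (A.op * A.evol t)) t := by
  have e : A.evol = fun u : ℝ => NormedSpace.exp (u • Complex.I • A.op) := funext fun u => by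
    rw [evol, ← smul_smul]
    rfl
  have h : HasDerivAt A.evol (A.evol t * (Complex.I • A.op)) t := by
    rw [e]
    exact hasDerivAt_exp_smul_const (𝕂 := ℝ) (Complex.I • A.op) t
  rwa [mul_smul_comm, ← (A.evol_commute (Commute.refl _) t).eq] at h

/-- `B` commutes with all shifts by `n ℤ^d`. -/
def _root_.EllTwo.IsPeriodicOp (n : ℕ) (B : EllTwo d →L[ℂ] EllTwo d) : Prop :=
  ∀ v : Fin d → ℤ, Commute B (shift ((n : ℤ) • v))

/-- A full-rank subgroup has finite index `n`, and `n v` then lies in it for every `v`. The cubic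
lattice `n ℤ^d` can therefore replace it. -/
theorem exists_period (hA : A.IsPeriodic) : ∃ n : ℕ, 0 < n ∧ IsPeriodicOp n A.op := by
  obtain ⟨L, hL, h⟩ := hA
  have hfin : Finite ((Fin d → ℤ) ⧸ (AddSubgroup.toIntSubmodule L)) :=
    Submodule.finiteQuotientOfFreeOfRankEq _ (by
      rw [Module.finrank_fin_fun]
      exact hL)
  have hfin' : Finite ((Fin d → ℤ) ⧸ L) := hfin
  refine ⟨L.index, Nat.pos_of_ne_zero ?_, fun v => ?_⟩
  · have : L.FiniteIndex := AddSubgroup.finiteIndex_of_finite_quotient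
    exact AddSubgroup.FiniteIndex.index_ne_zero
  · have h1 := h _ (by
      rw [natCast_zsmul]
      exact AddSubgroup.nsmul_index_mem L v : ((L.index : ℤ) • v) ∈ L)
    set w := (L.index : ℤ) • v
    change shift w * (A.op * shift (-w)) = A.op at h1
    change A.op * shift w = shift w * A.op
    conv_lhs => rw [← h1]
    rw [mul_assoc, mul_assoc, shift_neg_mul, mul_one]

end JacobiCoeff

end

/-! ### Commutators with `X_k` and the displacement `G(t)`. -/

noncomputable section

/-- If `T` intertwines `A` and `B`, it intertwines their exponentials. -/
theorem ContinuousLinearMap.comp_exp_of_intertwining {E F : Type*} [NormedAddCommGroup E]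
    [NormedSpace ℂ E] [CompleteSpace E] [NormedAddCommGroup F] [NormedSpace ℂ F] [CompleteSpace F]
    {A : E →L[ℂ] E} {B : F →L[ℂ] F} {T : E →L[ℂ] F} (h : ∀ u, T (A u) = B (T u)) (u : E) :
    T (NormedSpace.exp A u) = NormedSpace.exp B (T u) := by
  have hp : ∀ (n : ℕ) (u : E), T ((A ^ n) u) = (B ^ n) (T u) := by
    intro n
    induction n with
    | zero => intro u; rfl
    | succ m ih => intro u; rw [pow_succ, pow_succ, mul_apply_eq_comp, mul_apply_eq_comp, ih, h]
  have h1 := ((NormedSpace.exp_series_hasSum_exp' (𝕂 := ℂ) A).mapL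
    (ContinuousLinearMap.apply ℂ E u)).mapL T
  have h2 := (NormedSpace.exp_series_hasSum_exp' (𝕂 := ℂ) B).mapL
    (ContinuousLinearMap.apply ℂ F (T u))
  simp only [ContinuousLinearMap.apply_apply, map_smul, hp] at h1 h2
  exact h1.unique h2

/-- A closed subspace that is invariant under `A` is invariant under `exp A`. -/
theorem Submodule.exp_apply_mem {E : Type*} [NormedAddCommGroup E] [NormedSpace ℂ E]
    [CompleteSpace E] {S : Submodule ℂ E} (hS : IsClosed (S : Set E)) {A : E →L[ℂ] E}
    (h : ∀ u ∈ S, A u ∈ S) {u : E} (hu : u ∈ S) : NormedSpace.exp A u ∈ S := by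
  have hp : ∀ n : ℕ, (A ^ n) u ∈ S := by
    intro n
    induction n with
    | zero => exact hu
    | succ m ih => rw [pow_succ', mul_apply_eq_comp]; exact h _ ih
  refine hS.mem_of_tendsto ((NormedSpace.exp_series_hasSum_exp' (𝕂 := ℂ) A).mapL
    (ContinuousLinearMap.apply ℂ E u)) (Filter.Eventually.of_forall fun _ => ?_)
  refine S.sum_mem fun n _ => ?_
  simpa using S.smul_mem _ (hp n)

namespace EllTwo

variable {d : ℕ} {k : Fin d}

/-- The graph of the position operator `X_k`. -/
def posGraph (k : Fin d) : Submodule ℂ (EllTwo d × EllTwo d) where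
  carrier := {p | ∀ x, p.2 x = (x k : ℂ) * p.1 x}
  add_mem' := fun {p q} hp hq x => by
    simp only [Prod.fst_add, Prod.snd_add, lp.coeFn_add, Pi.add_apply, hp x, hq x]
    ring
  zero_mem' := fun x => by simp
  smul_mem' := fun c p hp x => by
    simp only [Prod.smul_fst, Prod.smul_snd, lp.coeFn_smul, Pi.smul_apply, hp x, smul_eq_mul]
    ring

theorem mem_posGraph {ψ φ : EllTwo d} :
    (ψ, φ) ∈ posGraph k ↔ ∀ x, φ x = (x k : ℂ) * ψ x := Iff.rfl

theorem continuous_apply (x : Fin d → ℤ) : Continuous fun u : EllTwo d => (u x : ℂ) := by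
  have : (fun u : EllTwo d => (u x : ℂ)) = fun u => inner ℂ (delta x) u :=
    funext fun u => (inner_delta_left x u).symm
  rw [this]
  fun_prop

/-- The graph is cut out by pointwise equations. Closedness is what lets exponentials preserve it.
-/
theorem isClosed_posGraph (k : Fin d) :
    IsClosed (posGraph k : Set (EllTwo d × EllTwo d)) := by
  have : (posGraph k : Set (EllTwo d × EllTwo d)) = ⋂ x, {p | p.2 x = (x k : ℂ) * p.1 x} := by
    ext p
    simp only [Set.mem_iInter]
    rfl
  rw [this]
  refine isClosed_iInter fun x => isClosed_eq ?_ ?_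
  · exact (continuous_apply x).comp continuous_snd
  · exact continuous_const.mul ((continuous_apply x).comp continuous_fst)

theorem posGraph_delta (x : Fin d → ℤ) : (delta x, (x k : ℂ) • delta x) ∈ posGraph k := by
  rw [mem_posGraph]
  intro y
  rw [lp.coeFn_smul, Pi.smul_apply, delta_apply, smul_eq_mul]
  split_ifs with h
  · rw [h]
  · simp

theorem posGraph_unique {ψ φ φ' : EllTwo d} (h : (ψ, φ) ∈ posGraph k)
    (h' : (ψ, φ') ∈ posGraph k) : φ = φ' :=
  lp.ext (funext fun x => (h x).trans (h' x).symm)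

theorem mem_domain_of_posGraph {ψ φ : EllTwo d} (h : (ψ, φ) ∈ posGraph k) :
    ψ ∈ (posOp k).domain := by
  change Memℓp (fun x => (x k : ℂ) * ψ x : (Fin d → ℤ) → ℂ) 2
  rw [show (fun x => (x k : ℂ) * ψ x : (Fin d → ℤ) → ℂ) = φ from funext fun x => (h x).symm]
  exact φ.2

theorem posOp_mem_posGraph (ψ : (posOp k).domain) : (ψ.1, posOp k ψ) ∈ posGraph k := fun _ => rfl

theorem posGraph_symm {ψ φ ψ' φ' : EllTwo d} (h : (ψ, φ) ∈ posGraph k)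
    (h' : (ψ', φ') ∈ posGraph k) : inner ℂ φ ψ' = inner ℂ ψ φ' := by
  rw [lp.inner_eq_tsum, lp.inner_eq_tsum]
  refine tsum_congr fun x => ?_
  rw [h x, h' x]
  simp only [RCLike.inner_apply, map_mul]
  rw [map_intCast]
  ring

/-- The bounded operator `C` is the commutator `[X_k, B]`: on the domain of `X_k`, which `B`
preserves, `X_k B = B X_k + C`. -/
def PosComm (k : Fin d) (B C : EllTwo d →L[ℂ] EllTwo d) : Prop :=
  ∀ ψ φ, (ψ, φ) ∈ posGraph k → (B ψ, B φ + C ψ) ∈ posGraph k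

namespace PosComm

variable {B B' C C' : EllTwo d →L[ℂ] EllTwo d}

theorem unique (h : PosComm k B C) (h' : PosComm k B C') : C = C' :=
  clm_ext fun x => add_left_cancel
    (posGraph_unique (h _ _ (posGraph_delta x)) (h' _ _ (posGraph_delta x)))

theorem zero : PosComm k (0 : EllTwo d →L[ℂ] EllTwo d) 0 := fun ψ φ _ => by
  convert (posGraph k).zero_mem using 1
  simp

theorem add (h : PosComm k B C) (h' : PosComm k B' C') : PosComm k (B + B') (C + C') :=
  fun ψ φ hψ => by
    convert (posGraph k).add_mem (h _ _ hψ) (h' _ _ hψ) using 1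
    simp only [Prod.mk_add_mk, add_apply]
    congr 1
    abel

theorem smul (c : ℂ) (h : PosComm k B C) : PosComm k (c • B) (c • C) :=
  fun ψ φ hψ => by
    convert (posGraph k).smul_mem c (h _ _ hψ) using 1
    simp

theorem sum {ι : Type*} (s : Finset ι) {B C : ι → EllTwo d →L[ℂ] EllTwo d}
    (h : ∀ i ∈ s, PosComm k (B i) (C i)) : PosComm k (∑ i ∈ s, B i) (∑ i ∈ s, C i) := by
  classical
  induction s using Finset.induction_on with
  | empty => exact zero
  | insert i s hi ih =>
    rw [Finset.sum_insert hi, Finset.sum_insert hi]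
    exact (h i (Finset.mem_insert_self i s)).add
      (ih fun j hj => h j (Finset.mem_insert_of_mem hj))

theorem mul (h : PosComm k B C) (h' : PosComm k B' C') :
    PosComm k (B * B') (B * C' + C * B') := fun ψ φ hψ => by
  convert h _ _ (h' _ _ hψ) using 1
  simp only [mul_apply_eq_comp, add_apply, map_add]
  congr 1
  abel

theorem shift (v : Fin d → ℤ) : PosComm k (shift v) ((v k : ℂ) • shift v) := fun ψ φ hψ x => by
  have h : φ (x - v) = ((x - v) k : ℂ) * ψ (x - v) := hψ (x - v)
  simp only [lp.coeFn_add, Pi.add_apply, smul_apply, lp.coeFn_smul, Pi.smul_apply,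
    shift_apply, smul_eq_mul, h, Pi.sub_apply]
  push_cast
  ring

theorem mulOp {c : (Fin d → ℤ) → ℂ} {M : ℝ} (hc : ∀ x, ‖c x‖ ≤ M) :
    PosComm k (mulOp c M hc) 0 := fun ψ φ hψ x => by
  have h : φ x = (x k : ℂ) * ψ x := hψ x
  simp only [zero_apply, add_zero, mulOp_apply, h]
  ring

/-- Although `X_k` does not commute with `U^v`, the commutator `[X_k, U^v] = v_k U^v` is a multiple
of `U^v`, so the extra terms cancel. -/
theorem commute_shift (h : PosComm k B C) {v : Fin d → ℤ} (hv : Commute B (EllTwo.shift v)) :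
    Commute C (EllTwo.shift v) := by
  have h1 := h.mul (shift (k := k) v)
  rw [hv.eq] at h1
  have h2 := h1.unique ((shift v).mul h)
  rw [mul_smul_comm, smul_mul_assoc, hv.eq, add_comm] at h2
  exact add_right_cancel h2

end PosComm

end EllTwo

namespace JacobiCoeff

open EllTwo

variable {d : ℕ} (A : JacobiCoeff d) {k : Fin d}

/-- `J` is a finite sum of multiplications, which commute with `X_k`, times shifts, whose
commutators with `X_k` are bounded. -/
theorem exists_posComm_op (k : Fin d) : ∃ K, PosComm k A.op K := by
  obtain ⟨C, hC⟩ := A.bounded_a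
  obtain ⟨B, hB⟩ := A.bounded_b
  have hC' : ∀ v ∈ nbrs (0 : Fin d → ℤ), ∀ x, ‖A.a x (x - v)‖ ≤ C := by
    intro v hv x
    refine hC _ _ ?_
    rw [mem_nbrs] at hv
    simpa [Nbr] using hv
  have h : A.op = ∑ v ∈ (nbrs (0 : Fin d → ℤ)).attach,
      mulOp (fun x => A.a x (x - v)) C (hC' v.1 v.2) * shift v.1
      + mulOp (fun x => (A.b x : ℂ)) B (by simpa using hB) := by
    ext1 u
    refine lp.ext (funext fun x => ?_)
    rw [op_apply, sum_nbrs, ← Finset.sum_attach (nbrs (0 : Fin d → ℤ)), add_apply, lp.coeFn_add,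
      Pi.add_apply, mulOp_apply, sum_apply, lp.coeFn_sum, Finset.sum_apply]
    rfl
  rw [h]
  exact ⟨_, (PosComm.sum _ fun v _ => (PosComm.mulOp _).mul (PosComm.shift v.1)).add
    (PosComm.mulOp _)⟩

/-- The commutators `[X_k, e^{itJ}]` are bounded and solve the Duhamel equation. -/
theorem exists_posComm_evol {K : EllTwo d →L[ℂ] EllTwo d} (hK : PosComm k A.op K) :
    ∃ E : ℝ → EllTwo d →L[ℂ] EllTwo d, E 0 = 0 ∧
      (∀ t, HasDerivAt E (Complex.I • (K * A.evol t + A.op * E t)) t) ∧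
      ∀ t, PosComm k (A.evol t) (E t) := by
  let H := EllTwo d
  -- The block-triangular operator `(u, w) ↦ (J u, K u + J w)` preserves the closed graph of `X_k`,
  -- and so does its exponential. The off-diagonal block of the exponential is the commutator
  -- sought, so no domain question arises.
  let 𝕁 : (H × H) →L[ℂ] (H × H) := (A.op ∘L ContinuousLinearMap.fst ℂ H H).prod
    (K ∘L ContinuousLinearMap.fst ℂ H H + A.op ∘L ContinuousLinearMap.snd ℂ H H)
  let 𝔼 : ℝ → (H × H) →L[ℂ] (H × H) := fun t => NormedSpace.exp (((t : ℂ) * Complex.I) • 𝕁)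
  have e1 : ∀ t p, (𝔼 t p).1 = A.evol t p.1 := fun t p =>
    ContinuousLinearMap.comp_exp_of_intertwining (T := ContinuousLinearMap.fst ℂ H H)
      (A := ((t : ℂ) * Complex.I) • 𝕁) (B := ((t : ℂ) * Complex.I) • A.op) (fun u => rfl) p
  have e2 : ∀ t u, 𝔼 t (0, u) = (0, A.evol t u) := fun t u =>
    (ContinuousLinearMap.comp_exp_of_intertwining (T := ContinuousLinearMap.inr ℂ H H)
      (B := ((t : ℂ) * Complex.I) • 𝕁) (A := ((t : ℂ) * Complex.I) • A.op)
      (fun u => Prod.ext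
        (show (0 : EllTwo d) = ((t : ℂ) * Complex.I) • A.op 0 by simp)
        (show ((t : ℂ) * Complex.I) • A.op u = ((t : ℂ) * Complex.I) • (K 0 + A.op u) by
          simp)) u).symm
  let E : ℝ → H →L[ℂ] H := fun t =>
    (ContinuousLinearMap.snd ℂ H H ∘L 𝔼 t) ∘L ContinuousLinearMap.inl ℂ H H
  have e3 : ∀ t ψ φ, 𝔼 t (ψ, φ) = (A.evol t ψ, A.evol t φ + E t ψ) := fun t ψ φ => by
    have : ((ψ, φ) : H × H) = (0, φ) + (ψ, 0) := by simp
    refine Prod.ext (e1 t _) ?_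
    rw [this, map_add, e2, Prod.snd_add]
    rfl
  refine ⟨E, ?_, fun t => ?_, fun t ψ φ hψ => ?_⟩
  · ext1 u
    simp [E, 𝔼]
  · have h𝔼 : HasDerivAt 𝔼 ((Complex.I • 𝕁) * 𝔼 t) t := by
      have h := hasDerivAt_exp_smul_const (𝕂 := ℝ) (Complex.I • 𝕁) t
      have e : 𝔼 = fun u : ℝ => NormedSpace.exp (u • Complex.I • 𝕁) := funext fun u => by
        simp only [𝔼]
        rw [← smul_smul]
        rfl
      have hc : Commute (Complex.I • 𝕁) (𝔼 t) :=
        (((Commute.refl 𝕁).smul_left _).smul_right _).exp_right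
      rw [hc.eq]
      rw [e]
      exact h
    let Λ : ((H × H) →L[ℂ] (H × H)) →L[ℝ] (H →L[ℂ] H) :=
      (((ContinuousLinearMap.compL ℂ H (H × H) H).flip
          (ContinuousLinearMap.inl ℂ H H)) ∘L
        (ContinuousLinearMap.compL ℂ (H × H) (H × H) H
          (ContinuousLinearMap.snd ℂ H H))).restrictScalars ℝ
    have h := Λ.hasFDerivAt.comp_hasDerivAt t h𝔼
    refine h.congr_deriv (ContinuousLinearMap.ext fun u => ?_)
    symm
    change _ = Complex.I • (K (𝔼 t (u, 0)).1 + A.op (𝔼 t (u, 0)).2)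
    rw [e1]
    rfl
  · rw [← e3]
    refine Submodule.exp_apply_mem (isClosed_posGraph k) ?_ hψ
    rintro ⟨u, w⟩ hu
    refine (posGraph k).smul_mem _ ?_
    convert hK u w hu using 1
    exact Prod.ext rfl (add_comm _ _)

/-- `X_k(t) = X_k + G(t)` with bounded `G`, the integral of the velocity
`-i e^{itJ} [X_k, J] e^{-itJ}`. -/
theorem exists_displacement {K : EllTwo d →L[ℂ] EllTwo d} (hK : PosComm k A.op K) :
    ∃ G : ℝ → EllTwo d →L[ℂ] EllTwo d, G 0 = 0 ∧
      (∀ t, HasDerivAt G (A.evol t * (-Complex.I • K) * A.evol (-t)) t) ∧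
      ∀ t, PosComm k (A.evol (-t)) (A.evol (-t) * G t) := by
  obtain ⟨E, hE0, hE, hcomm⟩ := A.exists_posComm_evol hK
  refine ⟨fun t => A.evol t * E (-t), by simp [hE0], fun t => ?_, fun t => ?_⟩
  · have h1 : HasDerivAt (fun t => E (-t)) _ t := (hE (-t)).scomp t (hasDerivAt_neg t)
    refine ((A.hasDerivAt_evol t).mul h1).congr_deriv ?_
    rw [(A.evol_commute (Commute.refl _) t).eq]
    simp only [neg_smul, one_smul, mul_add, smul_add, mul_neg, neg_mul, mul_smul_comm,
      smul_mul_assoc, mul_assoc]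
    abel
  · rw [← mul_assoc, evol_neg_mul, one_mul]
    exact hcomm (-t)

section Displacement

variable {A} {G : ℝ → EllTwo d →L[ℂ] EllTwo d}

/-- Expand the commutator of `X_k` with `e^{-isJ} e^{-itJ}` by the product rule and use that
commutators are unique. -/
theorem displacement_add (hG : ∀ t, PosComm k (A.evol (-t)) (A.evol (-t) * G t)) (s t : ℝ) :
    G (s + t) = G t + A.evol t * G s * A.evol (-t) := by
  have h := (hG s).mul (hG t)
  rw [← evol_add, ← neg_add] at h
  have h := congrArg (A.evol (s + t) * ·) (h.unique (hG (s + t)))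
  simp only [← mul_assoc, evol_mul_neg, one_mul, mul_add] at h
  rw [← h, ← evol_add, ← evol_add]
  congr 1
  · rw [show s + t + (-s) + (-t) = 0 by ring, evol_zero, one_mul]
  · rw [show s + t + (-s) = t by ring]

theorem displacement_commute_shift (hG : ∀ t, PosComm k (A.evol (-t)) (A.evol (-t) * G t))
    {v : Fin d → ℤ} (hv : Commute A.op (shift v)) (t : ℝ) : Commute (G t) (shift v) := by
  have h : ∀ s, Commute (A.evol s) (shift v) := fun s => (A.evol_commute hv.symm s).symm
  have h1 := (h t).mul_left ((hG t).commute_shift (h (-t)))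
  rwa [← mul_assoc, evol_mul_neg, one_mul] at h1

/-- `X_k` is symmetric and `e^{-itJ}` is unitary, so both `X_k` and `X_k + G(t)` have symmetric
matrix elements on the basis vectors. -/
theorem star_displacement (hG : ∀ t, PosComm k (A.evol (-t)) (A.evol (-t) * G t)) (t : ℝ) :
    star (G t) = G t := by
  refine clm_ext fun x => lp.ext (funext fun y => ?_)
  rw [← inner_delta_left, ← inner_delta_left, ContinuousLinearMap.star_eq_adjoint,
    ContinuousLinearMap.adjoint_inner_right]
  have hx := hG t _ _ (posGraph_delta x)
  have hy := hG t _ _ (posGraph_delta y)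
  have h := posGraph_symm hy hx
  have hu : ∀ u w, inner ℂ (A.evol (-t) u) (A.evol (-t) w) = inner ℂ u w := fun u w => by
    rw [← ContinuousLinearMap.adjoint_inner_right, ← ContinuousLinearMap.star_eq_adjoint,
      star_evol, ← mul_apply_eq_comp, neg_neg, evol_mul_neg, one_apply_eq_self]
  rw [mul_apply_eq_comp, mul_apply_eq_comp, ← map_add, ← map_add, hu, hu, inner_add_left,
    inner_add_right, posGraph_symm (posGraph_delta y) (posGraph_delta x)] at h
  exact add_left_cancel h

/-- At integer times the cocycle identity telescopes to an ergodic sum for conjugation by `e^{iJ}`.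
-/
theorem displacement_nat (hG0 : G 0 = 0)
    (hG : ∀ t, PosComm k (A.evol (-t)) (A.evol (-t) * G t)) (N : ℕ) :
    G N = ∑ j ∈ Finset.range N, A.evol 1 ^ j * G 1 * A.evol (-1) ^ j := by
  induction N with
  | zero => simpa using hG0
  | succ m ih =>
    rw [Finset.sum_range_succ, ← ih, ← evol_nat, ← evol_neg_nat, ← displacement_add hG]
    push_cast
    rw [add_comm]

end Displacement

end JacobiCoeff

end

/-! ### Mean ergodic theorem and existence of the asymptotic velocity. -/

noncomputable section

open Filter Topology

namespace EllTwo

variable {d : ℕ}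

/-- A bounded sequence of operators converging on the basis vectors converges strongly. -/
theorem exists_strong_lim {T : ℕ → EllTwo d →L[ℂ] EllTwo d} {C : ℝ} (hC : ∀ N, ‖T N‖ ≤ C)
    (h : ∀ x, ∃ l, Tendsto (fun N => T N (delta x)) atTop (𝓝 l)) :
    ∃ Q : EllTwo d →L[ℂ] EllTwo d, ∀ u, Tendsto (fun N => T N u) atTop (𝓝 (Q u)) := by
  have hC0 : 0 ≤ C := (norm_nonneg _).trans (hC 0)
  let S : Submodule ℂ (EllTwo d) :=
    { carrier := {u | ∃ l, Tendsto (fun N => T N u) atTop (𝓝 l)}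
      add_mem' := fun {u w} ⟨l, hl⟩ ⟨m, hm⟩ => ⟨l + m, by simpa using hl.add hm⟩
      zero_mem' := ⟨0, by simp⟩
      smul_mem' := fun c u ⟨l, hl⟩ => ⟨c • l, by simpa using hl.const_smul c⟩ }
  have hS : IsClosed (S : Set (EllTwo d)) := by
    refine isClosed_of_closure_subset fun u hu => ?_
    refine cauchySeq_tendsto_of_complete (Metric.cauchySeq_iff'.2 fun ε hε => ?_)
    obtain ⟨w, ⟨l, hl⟩, hw⟩ := Metric.mem_closure_iff.1 hu (ε / (3 * (C + 1))) (by positivity)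
    obtain ⟨M, hM⟩ := Metric.cauchySeq_iff'.1 hl.cauchySeq (ε / 3) (by positivity)
    have hd : ∀ N, dist (T N u) (T N w) < ε / 3 := fun N => by
      rw [dist_eq_norm, ← map_sub]
      refine ((T N).le_opNorm _).trans_lt ?_
      rw [dist_eq_norm, lt_div_iff₀ (by positivity)] at hw
      have h1 : ‖T N‖ * ‖u - w‖ ≤ C * ‖u - w‖ := by gcongr; exact hC N
      have h2 := norm_nonneg (u - w)
      have h3 : 3 * (C * ‖u - w‖) ≤ ‖u - w‖ * (3 * (C + 1)) := by linarith
      linarith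
    refine ⟨M, fun N hN => ?_⟩
    have h1 := hd N
    have h2 := hd M
    rw [dist_comm] at h2
    have h4 := dist_triangle4 (T N u) (T N w) (T M w) (T M u)
    linarith [hM N hN]
  have hall := mem_of_delta_mem hS h
  choose f hf using hall
  exact ⟨continuousLinearMapOfTendsto T (tendsto_pi_nhds.2 hf), hf⟩

namespace IsPeriodicOp

variable {n : ℕ} {B C : EllTwo d →L[ℂ] EllTwo d}

theorem mul (hB : IsPeriodicOp n B) (hC : IsPeriodicOp n C) : IsPeriodicOp n (B * C) :=
  fun v => (hB v).mul_left (hC v)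

theorem star (hB : IsPeriodicOp n B) : IsPeriodicOp n (Star.star B) := fun v => by
  have := (hB (-v)).star_star
  rwa [star_shift, smul_neg, neg_neg] at this

theorem apply_delta_add (hB : IsPeriodicOp n B) (x v : Fin d → ℤ) :
    B (delta (x + (n : ℤ) • v)) = shift ((n : ℤ) • v) (B (delta x)) := by
  rw [← shift_delta, ← mul_apply_eq_comp, (hB v).eq, mul_apply_eq_comp]

end IsPeriodicOp

/-- The fundamental cell `{0, …, n - 1}^d` of the lattice `n ℤ^d`. -/
abbrev Cell (n d : ℕ) : Type :=
  {x : Fin d → ℤ // x ∈ Fintype.piFinset fun _ => Finset.Ico 0 (n : ℤ)}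

/-- The representative of `y` modulo `n ℤ^d` in the fundamental cell. -/
def cellRep (n : ℕ) (hn : 0 < n) (y : Fin d → ℤ) : Cell n d :=
  ⟨fun j => y j % n, by
    rw [Fintype.mem_piFinset]
    intro j
    have : (n : ℤ) ≠ 0 := by exact_mod_cast hn.ne'
    rw [Finset.mem_Ico]
    exact ⟨Int.emod_nonneg _ this, Int.emod_lt_of_pos _ (by exact_mod_cast hn)⟩⟩

theorem cellRep_add (n : ℕ) (hn : 0 < n) (y : Fin d → ℤ) :
    (cellRep n hn y).1 + (n : ℤ) • (fun j => y j / n) = y :=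
  funext fun j => Int.emod_add_mul_ediv (y j) n

theorem cellRep_cell_add (n : ℕ) (hn : 0 < n) (x : Cell n d) (v : Fin d → ℤ) :
    cellRep n hn (x.1 + (n : ℤ) • v) = x := by
  refine Subtype.ext (funext fun j => ?_)
  have := Finset.mem_Ico.1 (Fintype.mem_piFinset.1 x.2 j)
  change (x.1 j + n * v j) % n = x.1 j
  rw [Int.add_mul_emod_self_left, Int.emod_eq_of_lt this.1 this.2]

/-- Transposition of the indices `(y, x)` of a kernel that is periodic under `n ℤ^d`. -/
def cellTransposeFun (n : ℕ) (hn : 0 < n) (p : Cell n d × (Fin d → ℤ)) :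
    Cell n d × (Fin d → ℤ) :=
  (cellRep n hn p.2, p.1.1 - (n : ℤ) • fun j => p.2 j / n)

/-- With `q = ⌊y/n⌋`, division of `x - n q` by `n` has remainder `x` and quotient `-q`, so the
second application restores `y`. -/
theorem cellTransposeFun_involutive (n : ℕ) (hn : 0 < n) :
    Function.Involutive (cellTransposeFun (d := d) n hn) := by
  rintro ⟨x, y⟩
  have hn' : (n : ℤ) ≠ 0 := by exact_mod_cast hn.ne'
  have h1 : cellRep n hn (x.1 - (n : ℤ) • fun j => y j / n) = x := by
    rw [sub_eq_add_neg, ← smul_neg, cellRep_cell_add]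
  have h2 := cellRep_add n hn (x.1 - (n : ℤ) • fun j => y j / n)
  refine Prod.ext h1 ?_
  change (cellRep n hn y).1 -
    (n : ℤ) • (fun j => (x.1 - (n : ℤ) • fun j => y j / n) j / (n : ℤ)) = y
  rw [h1] at h2
  rw [add_left_cancel (h2.trans (sub_eq_add_neg _ _)), sub_neg_eq_add, cellRep_add]

/-- Transposition of the indices `(y, x)` of a kernel that is periodic under `n ℤ^d`. -/
def cellTranspose (n : ℕ) (hn : 0 < n) : Cell n d × (Fin d → ℤ) ≃ Cell n d × (Fin d → ℤ) :=
  (cellTransposeFun_involutive n hn).toPerm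

/-- The Hilbert space of kernels that are periodic under `n ℤ^d` and square summable per cell. -/
abbrev CellSpace (n d : ℕ) : Type := PiLp 2 (fun _ : Cell n d => EllTwo d)

namespace CellSpace

variable {n : ℕ}

theorem summable_norm_sq (g : CellSpace n d) :
    Summable fun p : Cell n d × (Fin d → ℤ) => ‖(g p.1 p.2 : ℂ)‖ ^ 2 := by
  rw [summable_prod_of_nonneg (fun _ => by positivity)]
  exact ⟨fun x => (mem_iff _).1 (g x).2, Summable.of_finite⟩

theorem norm_sq_eq (g : CellSpace n d) :
    ‖g‖ ^ 2 = ∑' p : Cell n d × (Fin d → ℤ), ‖(g p.1 p.2 : ℂ)‖ ^ 2 := by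
  rw [g.summable_norm_sq.tsum_prod, tsum_fintype, PiLp.norm_sq_eq_of_L2]
  exact Finset.sum_congr rfl fun x _ => EllTwo.norm_sq _

/-- The adjoint of a periodic kernel. -/
def conjTranspose (n d : ℕ) (hn : 0 < n) : CellSpace n d →L⋆[ℂ] CellSpace n d :=
  LinearMap.mkContinuous
    { toFun := fun g => WithLp.toLp 2 fun x => ⟨fun y => starRingEnd ℂ
        (g (cellTranspose n hn (x, y)).1 (cellTranspose n hn (x, y)).2), by
          refine (EllTwo.mem_iff _).2 ?_
          simp only [RCLike.norm_conj]
          exact ((cellTranspose n hn).summable_iff.2 g.summable_norm_sq).prod_factor x⟩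
      map_add' := fun g h => by
        ext x : 1
        exact lp.ext (funext fun y => map_add (starRingEnd ℂ) _ _)
      map_smul' := fun c g => by
        ext x : 1
        exact lp.ext (funext fun y => map_mul (starRingEnd ℂ) _ _) } 1 (by
    intro g
    refine (sq_le_sq₀ (norm_nonneg _) (by positivity)).1 ?_
    rw [one_mul, norm_sq_eq, norm_sq_eq]
    refine le_of_eq (Eq.trans ?_ ((cellTranspose n hn).tsum_eq _))
    refine tsum_congr fun p => ?_
    exact congrArg (· ^ 2) (RCLike.norm_conj _))

/-- The kernel of the operator `B`. -/
def ofOp (n : ℕ) (B : EllTwo d →L[ℂ] EllTwo d) : CellSpace n d :=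
  WithLp.toLp 2 fun x => B (delta x.1)

theorem conjTranspose_ofOp (hn : 0 < n) {B : EllTwo d →L[ℂ] EllTwo d} (hB : IsPeriodicOp n B) :
    conjTranspose n d hn (ofOp n B) = ofOp n (star B) := by
  ext x : 1
  refine lp.ext (funext fun y => ?_)
  change starRingEnd ℂ (B (delta (cellRep n hn y).1) (x.1 - (n : ℤ) • fun j => y j / n)) =
    star B (delta x.1) y
  rw [adjoint_apply_delta]
  conv_rhs => rw [← cellRep_add n hn y, hB.apply_delta_add, shift_apply]

/-- Left multiplication of kernels by an operator. -/
def mulLeft (n : ℕ) (W : EllTwo d →L[ℂ] EllTwo d) : CellSpace n d →ₗ[ℂ] CellSpace n d where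
  toFun := fun g => WithLp.toLp 2 fun x => W (g x)
  map_add' := fun g h => by
    ext x : 1
    exact W.map_add _ _
  map_smul' := fun c g => by
    ext x : 1
    exact W.map_smul _ _

theorem mulLeft_ofOp (W B : EllTwo d →L[ℂ] EllTwo d) : mulLeft n W (ofOp n B) = ofOp n (W * B) :=
  rfl

theorem norm_mulLeft_le {W : EllTwo d →L[ℂ] EllTwo d} (hW : ‖W‖ ≤ 1) (g : CellSpace n d) :
    ‖mulLeft n W g‖ ≤ 1 * ‖g‖ := by
  refine (sq_le_sq₀ (norm_nonneg _) (by positivity)).1 ?_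
  rw [one_mul, PiLp.norm_sq_eq_of_L2, PiLp.norm_sq_eq_of_L2]
  refine Finset.sum_le_sum fun x _ => ?_
  gcongr
  exact (W.le_opNorm _).trans (mul_le_of_le_one_left (norm_nonneg _) hW)

end CellSpace

open CellSpace in
/-- The mean ergodic theorem for conjugation by a contraction on periodic operators. -/
theorem exists_tendsto_average {n : ℕ} (hn : 0 < n) {W B : EllTwo d →L[ℂ] EllTwo d}
    (hW : ‖W‖ ≤ 1) (hWp : IsPeriodicOp n W) (hB : IsPeriodicOp n B) (x : Fin d → ℤ) :
    ∃ l, Tendsto (fun N : ℕ => ((N : ℂ)⁻¹ • ∑ j ∈ Finset.range N, W ^ j * B * star W ^ j)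
      (delta x)) atTop (𝓝 l) := by
  let L : CellSpace n d →L[ℂ] CellSpace n d := (mulLeft n W).mkContinuous 1 (norm_mulLeft_le hW)
  let S := conjTranspose n d hn
  -- Only left multiplication acts column by column, so right multiplication by `W*` is done through
  -- adjoints: `D ↦ D* ↦ W D* ↦ D W* ↦ W D W*`. The two conjugate-linear factors make `Φ` linear.
  let Φ : CellSpace n d →L[ℂ] CellSpace n d := L.comp (S.comp (L.comp S))
  have hL : ‖L‖ ≤ 1 := LinearMap.mkContinuous_norm_le _ zero_le_one _
  have hS : ‖S‖ ≤ 1 := LinearMap.mkContinuous_norm_le _ zero_le_one _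
  have hΦ : ‖Φ‖ ≤ 1 := by
    refine ContinuousLinearMap.opNorm_le_bound _ zero_le_one fun g => ?_
    rw [one_mul]
    exact (L.le_of_opNorm_le hL _).trans (by
      rw [one_mul]
      exact (S.le_of_opNorm_le hS _).trans (by
        rw [one_mul]
        exact (L.le_of_opNorm_le hL _).trans (by
          rw [one_mul]
          simpa using S.le_of_opNorm_le hS g)))
  have hstep : ∀ D, IsPeriodicOp n D → Φ (ofOp n D) = ofOp n (W * D * star W) := fun D hD => by
    change mulLeft n W (conjTranspose n d hn (mulLeft n W (conjTranspose n d hn (ofOp n D)))) = _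
    rw [conjTranspose_ofOp hn hD, mulLeft_ofOp, conjTranspose_ofOp hn (hWp.mul hD.star),
      mulLeft_ofOp, star_mul, star_star, mul_assoc]
  have hiter : ∀ j : ℕ, IsPeriodicOp n (W ^ j * B * star W ^ j) ∧
      Φ^[j] (ofOp n B) = ofOp n (W ^ j * B * star W ^ j) := by
    intro j
    induction j with
    | zero => simpa using hB
    | succ m ih =>
      have e : W ^ (m + 1) * B * star W ^ (m + 1) = W * (W ^ m * B * star W ^ m) * star W := by
        rw [pow_succ', pow_succ]
        simp only [mul_assoc]
      rw [e, Function.iterate_succ_apply', ih.2]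
      exact ⟨(hWp.mul ih.1).mul hWp.star, hstep _ ih.1⟩
  have hlim := Φ.tendsto_birkhoffAverage_orthogonalProjection hΦ (ofOp n B)
  have hcell : ∀ x : Cell n d, ∃ l, Tendsto (fun N : ℕ =>
      ((N : ℂ)⁻¹ • ∑ j ∈ Finset.range N, W ^ j * B * star W ^ j) (delta x.1)) atTop (𝓝 l) := by
    intro x
    refine ⟨_, (((PiLp.proj 2 (𝕜 := ℂ) (fun _ : Cell n d => EllTwo d) x).continuous.tendsto _).comp
      hlim).congr fun N => ?_⟩
    simp only [Function.comp_apply, birkhoffAverage, birkhoffSum, id, map_smul, map_sum, hiter,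
      smul_apply, sum_apply]
    rfl
  -- The other basis vectors are translates of those in the cell by periods, and the averages
  -- commute with these translations.
  obtain ⟨l, hl⟩ := hcell (cellRep n hn x)
  refine ⟨shift ((n : ℤ) • fun j => x j / n) l,
    (((shift ((n : ℤ) • fun j => x j / n)).continuous.tendsto _).comp hl).congr fun N => ?_⟩
  simp only [Function.comp_apply, smul_apply, sum_apply, map_smul, map_sum]
  congr 1
  refine Finset.sum_congr rfl fun j _ => ?_
  rw [← (hiter j).1.apply_delta_add, cellRep_add]

end EllTwo

namespace JacobiCoeff

open EllTwo

variable {d : ℕ} {A : JacobiCoeff d} {k : Fin d} {G : ℝ → EllTwo d →L[ℂ] EllTwo d}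

/-- Continuity bounds `G` on `[0, 1]`, and `G(N)` is a sum of `N` unitary conjugates of `G(1)`. -/
theorem displacement_bounded (hG0 : G 0 = 0)
    (hG : ∀ t, PosComm k (A.evol (-t)) (A.evol (-t) * G t)) (hc : Continuous G) :
    ∃ C, 0 ≤ C ∧ (∀ t ∈ Set.Icc (0 : ℝ) 1, ‖G t‖ ≤ C) ∧
      ∀ N : ℕ, ‖((N : ℂ))⁻¹ • G N‖ ≤ C := by
  obtain ⟨C, hC⟩ := (isCompact_Icc (a := (0 : ℝ)) (b := 1)).exists_bound_of_continuousOn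
    hc.continuousOn
  have hC0 : 0 ≤ C := (norm_nonneg _).trans (hC 0 (by simp))
  refine ⟨C, hC0, hC, fun N => ?_⟩
  rcases Nat.eq_zero_or_pos N with rfl | hN
  · simpa using hC0
  have h : ‖G N‖ ≤ N * C := by
    rw [displacement_nat hG0 hG]
    refine (norm_sum_le _ _).trans ?_
    refine (Finset.sum_le_card_nsmul _ _ C fun j _ => ?_).trans (by simp)
    rw [← evol_nat, ← evol_neg_nat]
    exact (A.norm_conj_le j _).trans (hC 1 (by simp))
  rw [norm_smul, norm_inv, Complex.norm_natCast, inv_mul_le_iff₀ (by exact_mod_cast hN)]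
  exact h

/-- Integer times are covered by the ergodic theorem. For real `t`, `G(t)` differs from `G(⌊t⌋)` by
a conjugate of `G(t - ⌊t⌋)`, which is bounded and disappears after division by `t`. -/
theorem exists_asymptotic_velocity {n : ℕ} (hn : 0 < n) (hA : IsPeriodicOp n A.op)
    (hG0 : G 0 = 0) (hG : ∀ t, PosComm k (A.evol (-t)) (A.evol (-t) * G t)) (hc : Continuous G) :
    ∃ Q : EllTwo d →L[ℂ] EllTwo d,
      ∀ u, Tendsto (fun t : ℝ => (t : ℂ)⁻¹ • G t u) atTop (𝓝 (Q u)) := by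
  obtain ⟨C, hC0, hC, hCN⟩ := displacement_bounded hG0 hG hc
  obtain ⟨Q, hQ⟩ := exists_strong_lim hCN fun x => by
    obtain ⟨l, hl⟩ := exists_tendsto_average hn (A.norm_evol_le 1)
      (fun v => (A.evol_commute (hA v).symm 1).symm)
      (fun v => displacement_commute_shift hG (hA v) 1) x
    refine ⟨l, hl.congr fun N => ?_⟩
    rw [displacement_nat hG0 hG, star_evol]
  refine ⟨Q, fun u => ?_⟩
  have hfloor : Tendsto (fun t : ℝ => ((⌊t⌋₊ : ℝ) / t : ℝ)) atTop (𝓝 1) :=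
    tendsto_nat_floor_div_atTop
  have h1 : Tendsto (fun t : ℝ => (((⌊t⌋₊ : ℝ) / t : ℝ) : ℂ) • ((⌊t⌋₊ : ℂ)⁻¹ • G ⌊t⌋₊) u) atTop
      (𝓝 (((1 : ℝ) : ℂ) • Q u)) :=
    ((Complex.continuous_ofReal.tendsto _).comp hfloor).smul
      ((hQ u).comp tendsto_nat_floor_atTop)
  rw [Complex.ofReal_one, one_smul] at h1
  refine h1.congr_dist ?_
  have h2 : Tendsto (fun t : ℝ => t⁻¹ * (C * ‖u‖)) atTop (𝓝 0) := by
    simpa using tendsto_inv_atTop_zero.mul_const (C * ‖u‖)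
  refine squeeze_zero' (Eventually.of_forall fun _ => dist_nonneg) ?_ h2
  filter_upwards [eventually_ge_atTop (1 : ℝ)] with t ht
  have ht0 : 0 < t := by linarith
  have hf0 : (0 : ℝ) < ⌊t⌋₊ := by exact_mod_cast Nat.floor_pos.2 ht
  set f : ℕ := ⌊t⌋₊ with hf
  have hs : t = (t - f) + f := by ring
  have e1 : (((f : ℝ) / t : ℝ) : ℂ) • ((f : ℂ)⁻¹ • G f) u = (t : ℂ)⁻¹ • G f u := by
    rw [smul_apply, smul_smul]
    congr 1
    push_cast
    have : (f : ℂ) ≠ 0 := by exact_mod_cast hf0.ne'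
    field_simp
  rw [e1, dist_eq_norm, ← smul_sub, norm_smul, norm_inv, Complex.norm_real, Real.norm_eq_abs,
    abs_of_pos ht0]
  gcongr
  conv_lhs => rw [hs, displacement_add hG]
  rw [add_apply, sub_add_cancel_left, norm_neg]
  refine (ContinuousLinearMap.le_opNorm _ _).trans ?_
  gcongr
  refine (A.norm_conj_le _ _).trans (hC _ ⟨?_, ?_⟩)
  · linarith [Nat.floor_le ht0.le]
  · linarith [Nat.lt_floor_add_one t]

end JacobiCoeff

end

/-! ### From finitely supported functions to `ℓ²(ℤ^d)`: dimension count in boxes. -/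

noncomputable section

open Filter Topology

namespace EllTwo

variable {d : ℕ}

/-- `B` has range at most `ρ`: the value of `B u` at `y` only depends on the values of `u` at
distance at most `ρ` from `y`. -/
def HasRange (ρ : ℕ) (B : EllTwo d →L[ℂ] EllTwo d) : Prop :=
  ∀ (u : EllTwo d) (y : Fin d → ℤ), (∀ x, (∀ j, |x j - y j| ≤ ρ) → u x = 0) → B u y = 0

/-- The box `{a, …, b - 1}^d`. -/
def box (d : ℕ) (a b : ℤ) : Finset (Fin d → ℤ) := Fintype.piFinset fun _ => Finset.Ico a b

theorem mem_box {a b : ℤ} {x : Fin d → ℤ} : x ∈ box d a b ↔ ∀ j, a ≤ x j ∧ x j < b := by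
  simp [box, Fintype.mem_piFinset]

theorem card_box (a b : ℤ) : (box d a b).card = (b - a).toNat ^ d := by
  simp [box, Fintype.card_piFinset]

/-- Restriction of functions to a finite set. -/
def restrict (s : Finset (Fin d → ℤ)) : EllTwo d →L[ℂ] EllTwo d :=
  mulOp (fun x => if x ∈ s then 1 else 0) 1 (fun x => by split_ifs <;> simp)

theorem restrict_apply (s : Finset (Fin d → ℤ)) (u : EllTwo d) (x : Fin d → ℤ) :
    restrict s u x = if x ∈ s then u x else 0 := by
  rw [restrict, mulOp_apply]
  split_ifs <;> simp

theorem inner_eq_sum {s : Finset (Fin d → ℤ)} {w : EllTwo d} (hw : ∀ x ∉ s, w x = 0)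
    (u : EllTwo d) : inner ℂ w u = ∑ x ∈ s, starRingEnd ℂ (w x) * u x := by
  rw [lp.inner_eq_tsum, tsum_eq_sum (s := s)]
  · exact Finset.sum_congr rfl fun x _ => by rw [RCLike.inner_apply, mul_comm]
  · intro x hx
    rw [hw x hx, inner_zero_left]

/-- The trace of the compression of an orthogonal projection to a finite set is at most the
dimension of the space of restrictions. -/
theorem sum_norm_starProjection_le (K : Submodule ℂ (EllTwo d)) [K.HasOrthogonalProjection]
    (s : Finset (Fin d → ℤ)) (W : Submodule ℂ (EllTwo d)) [FiniteDimensional ℂ W]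
    (hW : ∀ u ∈ K, restrict s u ∈ W) (hW' : ∀ w ∈ W, ∀ x ∉ s, w x = 0) :
    ∑ x ∈ s, ‖K.starProjection (delta x)‖ ^ 2 ≤ Module.finrank ℂ W := by
  set P := K.starProjection with hP
  have hsymm : ∀ u w, inner ℂ (P u) w = inner ℂ u (P w) :=
    fun u w => K.starProjection_isSymmetric u w
  have hidem : ∀ u, P (P u) = P u := fun u =>
    Submodule.starProjection_eq_self_iff.2 (K.starProjection_apply_mem u)
  have hnorm : ∀ u, ((‖P u‖ ^ 2 : ℝ) : ℂ) = inner ℂ (P u) u := fun u => by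
    rw [← hidem u, hsymm, hidem, inner_self_eq_norm_sq_to_K]
    norm_cast
  let e := stdOrthonormalBasis ℂ W
  -- Expanding the restriction of `P δ_x` in an orthonormal basis `e_i` of `W` and summing over `x ∈
  -- s` turns the trace into `∑ ‖P e_i‖²`, each term of which is at most 1.
  have key : ∀ x ∈ s, ((‖P (delta x)‖ ^ 2 : ℝ) : ℂ) =
      ∑ i, starRingEnd ℂ (P (e i).1 x) * (e i).1 x := by
    intro x hx
    have h1 : ((‖P (delta x)‖ ^ 2 : ℝ) : ℂ) = restrict s (P (delta x)) x := by
      rw [hnorm, hsymm, inner_delta_left, restrict_apply, if_pos hx]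
    let w : W := ⟨restrict s (P (delta x)), hW _ (K.starProjection_apply_mem _)⟩
    have h2 : restrict s (P (delta x)) = ∑ i, inner ℂ (e i) w • (e i).1 := by
      have h := congrArg Subtype.val (e.sum_repr' w)
      rw [AddSubmonoidClass.coe_finsetSum] at h
      exact h.symm
    rw [h1, h2, lp.coeFn_sum, Finset.sum_apply]
    refine Finset.sum_congr rfl fun i _ => ?_
    rw [lp.coeFn_smul, Pi.smul_apply, smul_eq_mul]
    congr 1
    change inner ℂ (e i).1 (restrict s (P (delta x))) = _
    have h3 : inner ℂ (e i).1 (restrict s (P (delta x))) = inner ℂ (e i).1 (P (delta x)) := by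
      rw [inner_eq_sum (hW' _ (e i).2), inner_eq_sum (hW' _ (e i).2)]
      exact Finset.sum_congr rfl fun y hy => by rw [restrict_apply, if_pos hy]
    rw [h3, ← hsymm, inner_delta_right]
  have hsum : ((∑ x ∈ s, ‖P (delta x)‖ ^ 2 : ℝ) : ℂ) = ((∑ i, ‖P (e i).1‖ ^ 2 : ℝ) : ℂ) := by
    rw [Complex.ofReal_sum, Complex.ofReal_sum, Finset.sum_congr rfl key, Finset.sum_comm]
    refine Finset.sum_congr rfl fun i _ => ?_
    rw [hnorm, ← inner_conj_symm, inner_eq_sum (hW' _ (e i).2), map_sum]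
    refine Finset.sum_congr rfl fun x _ => ?_
    rw [map_mul, Complex.conj_conj, mul_comm]
  rw [Complex.ofReal_inj.1 hsum]
  calc ∑ i, ‖P (e i).1‖ ^ 2 ≤ ∑ _i : Fin (Module.finrank ℂ W), (1 : ℝ) := by
        refine Finset.sum_le_sum fun i _ => pow_le_one₀ (norm_nonneg _) ?_
        refine (K.norm_starProjection_apply_le _).trans (le_of_eq ?_)
        exact e.orthonormal.1 i
    _ = Module.finrank ℂ W := by simp

/-- The kernel is invariant under shifts by periods and under their inverses, and shifts are
unitary. -/
theorem starProjection_shift {n : ℕ} {T : EllTwo d →L[ℂ] EllTwo d} (hT : IsPeriodicOp n T)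
    (v : Fin d → ℤ) (u : EllTwo d) :
    (LinearMap.ker T.toLinearMap).starProjection (shift ((n : ℤ) • v) u) =
      shift ((n : ℤ) • v) ((LinearMap.ker T.toLinearMap).starProjection u) := by
  set K := LinearMap.ker T.toLinearMap
  have hK : ∀ v : Fin d → ℤ, ∀ w ∈ K, shift ((n : ℤ) • v) w ∈ K := fun v w hw => by
    change T (shift ((n : ℤ) • v) w) = 0
    rw [← mul_apply_eq_comp, (hT v).eq, mul_apply_eq_comp, show T w = 0 from hw, map_zero]
  refine Submodule.eq_starProjection_of_mem_of_inner_eq_zero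
    (hK v _ (K.starProjection_apply_mem u)) fun w hw => ?_
  rw [← map_sub, ← ContinuousLinearMap.adjoint_inner_right, ← ContinuousLinearMap.star_eq_adjoint,
    star_shift, ← smul_neg]
  exact Submodule.starProjection_inner_eq_zero _ _ (hK _ _ hw)

/-- The space of restrictions to `s` of the kernel of `T` embeds into the functions on the
boundary of `s`, if `T` is injective on finitely supported functions. -/
theorem finrank_restrict_ker_le {ρ : ℕ} {T : EllTwo d →L[ℂ] EllTwo d} (hρ : HasRange ρ T)
    (hinj : ∀ u : EllTwo d, (Function.support u).Finite → T u = 0 → u = 0)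
    (s b : Finset (Fin d → ℤ))
    (hb : ∀ y ∉ b, (∀ x, (∀ j, |x j - y j| ≤ ρ) → x ∈ s) ∨ ∀ x, (∀ j, |x j - y j| ≤ ρ) → x ∉ s) :
    FiniteDimensional ℂ ((LinearMap.ker T.toLinearMap).map (restrict s).toLinearMap) ∧
      Module.finrank ℂ ((LinearMap.ker T.toLinearMap).map (restrict s).toLinearMap) ≤ b.card := by
  set W := (LinearMap.ker T.toLinearMap).map (restrict s).toLinearMap
  let Λ : W →ₗ[ℂ] (b → ℂ) :=
    { toFun := fun w y => T w.1 y.1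
      map_add' := fun w w' => funext fun y => by
        simp only [Submodule.coe_add, map_add, lp.coeFn_add, Pi.add_apply]
      map_smul' := fun c w => funext fun y => by
        simp only [Submodule.coe_smul, map_smul, lp.coeFn_smul, Pi.smul_apply,
          RingHom.id_apply] }
  -- Away from `b`, `T` sees either all of `u`, and `T u = 0`, or nothing of its restriction. If `T`
  -- of the restriction also vanishes on `b`, the restriction is a finitely supported element of the
  -- kernel.
  have hΛ : Function.Injective Λ := by
    rw [injective_iff_map_eq_zero]
    rintro ⟨w, hw⟩ h
    obtain ⟨u, hu, rfl⟩ := hw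
    have hu : T u = 0 := hu
    refine Subtype.ext (hinj _ (s.finite_toSet.subset fun x hx => ?_) ?_)
    · by_contra hxs
      exact hx ((restrict_apply s u x).trans (if_neg hxs))
    · refine lp.ext (funext fun y => ?_)
      change T (restrict s u) y = 0
      by_cases hy : y ∈ b
      · exact congrFun h ⟨y, hy⟩
      · rcases hb y hy with h1 | h1
        · have h2 := hρ (restrict s u - u) y fun x hx => by
            rw [lp.coeFn_sub, Pi.sub_apply, restrict_apply, if_pos (h1 x hx), sub_self]
          rwa [map_sub, hu, sub_zero] at h2
        · exact hρ _ y fun x hx => by rw [restrict_apply, if_neg (h1 x hx)]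
  refine ⟨FiniteDimensional.of_injective Λ hΛ, ?_⟩
  have := LinearMap.finrank_le_finrank_of_injective hΛ
  simpa using this

/-- A periodic operator of finite range that is injective on finitely supported functions is
injective on `ℓ²(ℤ^d)`. -/
theorem injective_of_finite_support {n ρ : ℕ} (hn : 0 < n) {T : EllTwo d →L[ℂ] EllTwo d}
    (hT : IsPeriodicOp n T) (hρ : HasRange ρ T)
    (hinj : ∀ u : EllTwo d, (Function.support u).Finite → T u = 0 → u = 0)
    {u : EllTwo d} (hu : T u = 0) : u = 0 := by
  set K := LinearMap.ker T.toLinearMap with hK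
  have hshift : ∀ x v : Fin d → ℤ, ‖K.starProjection (delta (x + (n : ℤ) • v))‖ =
      ‖K.starProjection (delta x)‖ := fun x v => by
    rw [← shift_delta, starProjection_shift hT, norm_shift]
  -- The box of side `n R` contains `R^d` translates of `x`, all with the same `‖P δ‖`. The
  -- right-hand side counts a shell of width `ρ` on either side of the boundary; `2ρ ≤ n R` keeps
  -- the inner side length nonnegative.
  have hbound : ∀ (x : Cell n d) (R : ℕ), 2 * ρ ≤ n * R →
      (R : ℝ) ^ d * ‖K.starProjection (delta x.1)‖ ^ 2 ≤
        ((n : ℝ) * R + 2 * ρ) ^ d - ((n : ℝ) * R - 2 * ρ) ^ d := by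
    intro x R hR
    let M : ℤ := n * R
    have hM : 2 * (ρ : ℤ) ≤ M := by
      change 2 * (ρ : ℤ) ≤ n * R
      exact_mod_cast hR
    obtain ⟨hfin, hdim⟩ := finrank_restrict_ker_le hρ hinj (box d 0 M)
      (box d (-ρ) (M + ρ) \ box d ρ (M - ρ)) (fun y hy => by
        rw [Finset.mem_sdiff, not_and_not_right] at hy
        by_cases h : y ∈ box d (-ρ) (M + ρ)
        · refine Or.inl fun x hx => mem_box.2 fun j => ?_
          have h1 := mem_box.1 (hy h) j
          have h2 := abs_le.1 (hx j)
          constructor <;> omega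
        · refine Or.inr fun x hx hxs => h (mem_box.2 fun j => ?_)
          have h1 := mem_box.1 hxs j
          have h2 := abs_le.1 (hx j)
          constructor <;> omega)
    have h1 := sum_norm_starProjection_le K (box d 0 M)
      ((LinearMap.ker T.toLinearMap).map (restrict (box d 0 M)).toLinearMap)
      (fun u hu => ⟨u, hu, rfl⟩) (by
        rintro _ ⟨u, _, rfl⟩ x hx
        exact (restrict_apply _ u x).trans (if_neg hx))
    have hsub : box d ρ (M - ρ) ⊆ box d (-ρ) (M + ρ) := fun y hy => mem_box.2 fun j => by
      have := mem_box.1 hy j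
      constructor <;> omega
    have hcard : (((box d (-ρ) (M + ρ) \ box d ρ (M - ρ)).card : ℕ) : ℝ) =
        ((n : ℝ) * R + 2 * ρ) ^ d - ((n : ℝ) * R - 2 * ρ) ^ d := by
      rw [Finset.card_sdiff_of_subset hsub, Nat.cast_sub (Finset.card_le_card hsub),
        card_box, card_box, Nat.cast_pow, Nat.cast_pow]
      congr 2
      · have : (((M + ρ - -ρ).toNat : ℕ) : ℤ) = n * R + 2 * ρ := by
          rw [Int.toNat_of_nonneg (by omega)]
          ring
        exact_mod_cast congrArg (Int.cast (R := ℝ)) this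
      · have : (((M - ρ - ρ).toNat : ℕ) : ℤ) = n * R - 2 * ρ := by
          rw [Int.toNat_of_nonneg (by omega)]
          ring
        exact_mod_cast congrArg (Int.cast (R := ℝ)) this
    have himage : (box d 0 R).image (fun v => x.1 + (n : ℤ) • v) ⊆ box d 0 M := by
      intro y hy
      obtain ⟨v, hv, rfl⟩ := Finset.mem_image.1 hy
      refine mem_box.2 fun j => ?_
      have h1 := mem_box.1 hv j
      have h2 := Finset.mem_Ico.1 (Fintype.mem_piFinset.1 x.2 j)
      change 0 ≤ x.1 j + n * v j ∧ x.1 j + n * v j < n * R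
      have hn' : (0 : ℤ) < n := by exact_mod_cast hn
      constructor
      · have := mul_nonneg hn'.le h1.1
        omega
      · have : (n : ℤ) * (v j + 1) ≤ n * R := by gcongr; omega
        rw [mul_add, mul_one] at this
        omega
    have hinj' : Function.Injective fun v : Fin d → ℤ => x.1 + (n : ℤ) • v := fun v w h => by
      have hn' : (n : ℤ) ≠ 0 := by exact_mod_cast hn.ne'
      exact smul_right_injective _ hn' (add_left_cancel h)
    calc (R : ℝ) ^ d * ‖K.starProjection (delta x.1)‖ ^ 2
        = ∑ y ∈ (box d 0 R).image (fun v => x.1 + (n : ℤ) • v),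
            ‖K.starProjection (delta y)‖ ^ 2 := by
          rw [Finset.sum_image fun v _ w _ h => hinj' h]
          simp only [hshift, Finset.sum_const, card_box, sub_zero, Int.toNat_natCast,
            nsmul_eq_mul, Nat.cast_pow]
      _ ≤ ∑ y ∈ box d 0 M, ‖K.starProjection (delta y)‖ ^ 2 :=
          Finset.sum_le_sum_of_subset_of_nonneg himage fun _ _ _ => by positivity
      _ ≤ _ := h1
      _ ≤ _ := by exact_mod_cast hdim
      _ = _ := hcard
  have hzero : ∀ x : Cell n d, K.starProjection (delta x.1) = 0 := by
    intro x
    -- After division by `R^d` the shell count tends to `n^d - n^d = 0`.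
    have hlim : Tendsto (fun R : ℕ => ((n : ℝ) + 2 * ρ * (R : ℝ)⁻¹) ^ d -
        ((n : ℝ) - 2 * ρ * (R : ℝ)⁻¹) ^ d) atTop (𝓝 0) := by
      have h : Tendsto (fun R : ℕ => 2 * (ρ : ℝ) * (R : ℝ)⁻¹) atTop (𝓝 0) := by
        simpa using tendsto_inv_atTop_nhds_zero_nat.const_mul (2 * (ρ : ℝ))
      simpa using ((h.const_add (n : ℝ)).pow d).sub ((h.const_sub (n : ℝ)).pow d)
    have hle : ‖K.starProjection (delta x.1)‖ ^ 2 ≤ 0 := by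
      refine ge_of_tendsto hlim ?_
      filter_upwards [eventually_ge_atTop (2 * ρ + 1)] with R hR
      have hR0 : (0 : ℝ) < R := by
        have : 0 < R := by omega
        exact_mod_cast this
      have h := hbound x R (by nlinarith)
      refine le_of_mul_le_mul_left (h.trans (le_of_eq ?_)) (pow_pos hR0 d)
      rw [mul_sub, ← mul_pow, ← mul_pow]
      congr 2 <;> field_simp
    exact norm_eq_zero.1 (pow_eq_zero_iff two_ne_zero |>.1 (le_antisymm hle (by positivity)))
  have hall : ∀ x, K.starProjection (delta x) = 0 := fun x => by
    rw [← norm_eq_zero, ← cellRep_add n hn x, hshift, hzero, norm_zero]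
  have huK : K.starProjection u = u := Submodule.starProjection_eq_self_iff.2 hu
  have hP0 : K.starProjection = 0 := clm_ext fun x => by rw [hall, zero_apply]
  rw [← huK, hP0, zero_apply]

end EllTwo

end

/-! ### Laurent polynomials and polynomials in a periodic operator. -/

noncomputable section

open Filter Topology Polynomial

/-- A normal element of square zero vanishes. -/
theorem CStarRing.eq_zero_of_mul_self_eq_zero {E : Type*} [NonUnitalNormedRing E] [StarRing E]
    [CStarRing E] {N : E} (hc : N * star N = star N * N) (h : N * N = 0) : N = 0 := by
  have h1 : star (star N * N) * (star N * N) = 0 := by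
    rw [star_mul, star_star]
    calc star N * N * (star N * N) = star N * (N * star N) * N := by simp only [mul_assoc]
      _ = star N * star N * (N * N) := by rw [hc]; simp only [mul_assoc]
      _ = 0 := by rw [h, mul_zero]
  rwa [CStarRing.star_mul_self_eq_zero_iff, CStarRing.star_mul_self_eq_zero_iff] at h1

/-- The group ring of `ℤ^d`, that is, the ring of Laurent polynomials in `d` variables. -/
abbrev LaurentRing (d : ℕ) : Type := AddMonoidAlgebra ℂ (Fin d → ℤ)

namespace LaurentRing

variable {d : ℕ}

/-- The logarithmic derivative `z_k ∂/∂z_k` on Laurent polynomials. -/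
def logDeriv (k : Fin d) : Derivation ℤ (LaurentRing d) (LaurentRing d) :=
  let δ : LaurentRing d →+ LaurentRing d :=
    { toFun := fun c => AddMonoidAlgebra.ofCoeff (Finsupp.onFinset c.coeff.support
        (fun v => (v k : ℂ) * c.coeff v) fun v hv => by
          rw [Finsupp.mem_support_iff]
          exact right_ne_zero_of_mul hv)
      map_zero' := by
        refine AddMonoidAlgebra.coeff_injective (Finsupp.ext fun v => ?_)
        simp
      map_add' := fun c c' => by
        refine AddMonoidAlgebra.coeff_injective (Finsupp.ext fun v => ?_)
        simp [mul_add] }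
  have hδ : ∀ v a, δ (AddMonoidAlgebra.single v a) =
      AddMonoidAlgebra.single v ((v k : ℂ) * a) := fun v a => by
    refine AddMonoidAlgebra.coeff_injective (Finsupp.ext fun w => ?_)
    change (w k : ℂ) * (AddMonoidAlgebra.single v a).coeff w = _
    rw [AddMonoidAlgebra.coeff_single, AddMonoidAlgebra.coeff_single, Finsupp.single_apply,
      Finsupp.single_apply]
    split_ifs with h
    · rw [h]
    · simp
  Derivation.mk' δ.toIntLinearMap (by
    intro c c'
    change δ (c * c') = c * δ c' + c' * δ c
    induction c using AddMonoidAlgebra.induction_linear with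
    | zero => simp
    | add c₁ c₂ h₁ h₂ =>
      rw [add_mul, map_add, map_add, h₁, h₂]
      ring
    | single v a =>
      induction c' using AddMonoidAlgebra.induction_linear with
      | zero => simp
      | add c₁ c₂ h₁ h₂ =>
        rw [mul_add, map_add, map_add, h₁, h₂]
        ring
      | single w b =>
        rw [AddMonoidAlgebra.single_mul_single, hδ, hδ, hδ, AddMonoidAlgebra.single_mul_single,
          AddMonoidAlgebra.single_mul_single, add_comm w v, ← AddMonoidAlgebra.single_add]
        congr 1
        rw [Pi.add_apply]
        push_cast
        ring)

theorem coeff_logDeriv (k : Fin d) (c : LaurentRing d) (v : Fin d → ℤ) :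
    (logDeriv k c).coeff v = (v k : ℂ) * c.coeff v := rfl

theorem logDeriv_single (k : Fin d) (v : Fin d → ℤ) (a : ℂ) :
    logDeriv k (AddMonoidAlgebra.single v a) = (v k : ℂ) • AddMonoidAlgebra.single v a := by
  refine AddMonoidAlgebra.coeff_injective (Finsupp.ext fun w => ?_)
  rw [coeff_logDeriv, AddMonoidAlgebra.coeff_smul_apply, AddMonoidAlgebra.coeff_single,
    Finsupp.single_apply, smul_eq_mul]
  split_ifs with h
  · rw [h]
  · simp

/-- The logarithmic derivative applied to the coefficients of a polynomial. -/
def polyLogDeriv (k : Fin d) : Derivation ℤ (LaurentRing d)[X] (LaurentRing d)[X] :=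
  let _ : Differential (LaurentRing d) := ⟨logDeriv k⟩
  Differential.mapCoeffs

theorem coeff_polyLogDeriv (k : Fin d) (p : (LaurentRing d)[X]) (i : ℕ) :
    (polyLogDeriv k p).coeff i = logDeriv k (p.coeff i) := rfl

theorem polyLogDeriv_C (k : Fin d) (c : LaurentRing d) :
    polyLogDeriv k (C c) = C (logDeriv k c) := by
  ext1 i
  rw [coeff_polyLogDeriv, coeff_C, coeff_C]
  split_ifs <;> simp

theorem polyLogDeriv_X (k : Fin d) : polyLogDeriv k X = 0 := by
  ext1 i
  rw [coeff_polyLogDeriv, coeff_X]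
  split_ifs <;> simp

/-- The representation of the group ring by shifts along `n ℤ^d`. -/
def rep (n : ℕ) : LaurentRing d →ₐ[ℂ] (EllTwo d →L[ℂ] EllTwo d) :=
  AddMonoidAlgebra.lift ℂ _ (Fin d → ℤ)
    { toFun := fun v => EllTwo.shift ((n : ℤ) • v.toAdd)
      map_one' := by
        rw [toAdd_one, smul_zero, EllTwo.shift_zero]
      map_mul' := fun v w => by
        rw [toAdd_mul, smul_add, EllTwo.shift_mul] }

theorem rep_single (n : ℕ) (v : Fin d → ℤ) (a : ℂ) :
    rep n (AddMonoidAlgebra.single v a) = a • EllTwo.shift ((n : ℤ) • v) :=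
  AddMonoidAlgebra.lift_single _ _ _

theorem rep_commute {n : ℕ} {B : EllTwo d →L[ℂ] EllTwo d} (hB : EllTwo.IsPeriodicOp n B)
    (c : LaurentRing d) : Commute (rep n c) B := by
  induction c using AddMonoidAlgebra.induction_linear with
  | zero => rw [map_zero]; exact Commute.zero_left _
  | add c₁ c₂ h₁ h₂ => rw [map_add]; exact h₁.add_left h₂
  | single v a => rw [rep_single]; exact (hB v).symm.smul_left _

theorem isPeriodicOp_rep (n : ℕ) (c : LaurentRing d) : EllTwo.IsPeriodicOp n (rep n c) :=
  fun v => rep_commute (fun w => by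
    change _ * _ = _ * _
    rw [EllTwo.shift_mul, EllTwo.shift_mul, add_comm]) c

/-- The monomial `z^v` acts as the shift by `n v`, whose commutator with `X_k` is `n v_k` times
itself; hence the factor `n`. -/
theorem posComm_rep (n : ℕ) (k : Fin d) (c : LaurentRing d) :
    EllTwo.PosComm k (rep n c) ((n : ℂ) • rep n (logDeriv k c)) := by
  induction c using AddMonoidAlgebra.induction_linear with
  | zero => simpa using EllTwo.PosComm.zero
  | add c₁ c₂ h₁ h₂ => rw [map_add, map_add, map_add, smul_add]; exact h₁.add h₂
  | single v a =>
    rw [logDeriv_single, map_smul, rep_single]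
    convert (EllTwo.PosComm.shift (k := k) ((n : ℤ) • v)).smul a using 1
    rw [smul_smul, smul_smul, smul_smul]
    congr 1
    simp only [Pi.smul_apply, smul_eq_mul, Int.cast_mul, Int.cast_natCast]
    ring

variable {n : ℕ} {B : EllTwo d →L[ℂ] EllTwo d}

/-- Evaluation at the periodic operator `B` of polynomials over the group ring. -/
def evalOp (hB : EllTwo.IsPeriodicOp n B) : (LaurentRing d)[X] →+* (EllTwo d →L[ℂ] EllTwo d) :=
  eval₂RingHom' (rep n).toRingHom B (rep_commute hB)

variable (hB : EllTwo.IsPeriodicOp n B)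

theorem evalOp_C (c : LaurentRing d) : evalOp hB (C c) = rep n c :=
  eval₂_C (rep n).toRingHom B

theorem evalOp_X : evalOp hB X = B := eval₂_X (rep n).toRingHom B

theorem evalOp_eq_sum (p : (LaurentRing d)[X]) :
    evalOp hB p = ∑ j ∈ p.support, rep n (p.coeff j) * B ^ j :=
  eval₂_eq_sum

theorem commute_evalOp {T : EllTwo d →L[ℂ] EllTwo d} (hT : EllTwo.IsPeriodicOp n T)
    (hBT : Commute B T) (p : (LaurentRing d)[X]) : Commute (evalOp hB p) T := by
  rw [evalOp_eq_sum]
  exact Commute.sum_left _ _ _ fun j _ => (rep_commute hT _).mul_left (hBT.pow_left j)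

theorem isPeriodicOp_evalOp (p : (LaurentRing d)[X]) :
    EllTwo.IsPeriodicOp n (evalOp hB p) := fun v => by
  rw [evalOp_eq_sum]
  exact Commute.sum_left _ _ _ fun j _ => (isPeriodicOp_rep n _ v).mul_left ((hB v).pow_left j)

/-- The operator commutes with the self-adjoint `B` and with the periods; so does its adjoint, which
therefore commutes with every polynomial in `B` over the group ring. -/
theorem commute_star_evalOp (hs : star B = B) (p : (LaurentRing d)[X]) :
    Commute (evalOp hB p) (star (evalOp hB p)) := by
  refine commute_evalOp hB (isPeriodicOp_evalOp hB p).star ?_ p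
  have h := (commute_evalOp hB hB (Commute.refl B) p).star_star
  rw [hs] at h
  exact h.symm

/-- The image of `evalOp` at a self-adjoint operator consists of normal operators, so it is
reduced. -/
theorem evalOp_eq_zero_of_sq (hs : star B = B) {p : (LaurentRing d)[X]}
    (h : evalOp hB (p * p) = 0) : evalOp hB p = 0 := by
  have hc := (commute_star_evalOp hB hs p).eq
  rw [map_mul] at h
  exact CStarRing.eq_zero_of_mul_self_eq_zero hc h

end LaurentRing

/-! ### Operators of finite range. -/

namespace EllTwo

variable {d : ℕ}

namespace HasRange

variable {ρ σ : ℕ} {B C : EllTwo d →L[ℂ] EllTwo d}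

theorem mono (hB : HasRange ρ B) (h : ρ ≤ σ) : HasRange σ B := fun u y hu =>
  hB u y fun x hx => hu x fun j => (hx j).trans (by exact_mod_cast h)

theorem mul (hB : HasRange ρ B) (hC : HasRange σ C) : HasRange (ρ + σ) (B * C) := fun u y hu => by
  refine hB _ y fun x hx => hC u x fun z hz => hu z fun j => ?_
  have h := abs_sub_le (z j) (x j) (y j)
  have h1 := hx j
  have h2 := hz j
  push_cast
  linarith

theorem add (hB : HasRange ρ B) (hC : HasRange σ C) : HasRange (max ρ σ) (B + C) := fun u y hu => by
  rw [add_apply, lp.coeFn_add, Pi.add_apply, hB.mono (le_max_left _ _) u y hu,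
    hC.mono (le_max_right _ _) u y hu, add_zero]

theorem zero : HasRange 0 (0 : EllTwo d →L[ℂ] EllTwo d) := fun _ _ _ => rfl

theorem one : HasRange 0 (1 : EllTwo d →L[ℂ] EllTwo d) := fun u y hu => by
  exact hu y fun j => by simp

theorem smul (c : ℂ) (hB : HasRange ρ B) : HasRange ρ (c • B) := fun u y hu => by
  rw [smul_apply, lp.coeFn_smul, Pi.smul_apply, hB u y hu, smul_zero]

theorem shift (v : Fin d → ℤ) : ∃ ρ, HasRange ρ (EllTwo.shift v) := by
  refine ⟨∑ j, (v j).natAbs, fun u y hu => ?_⟩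
  refine hu _ fun j => ?_
  have : (v j).natAbs ≤ ∑ j, (v j).natAbs :=
    Finset.single_le_sum (f := fun j => (v j).natAbs) (fun _ _ => Nat.zero_le _)
      (Finset.mem_univ j)
  rw [Pi.sub_apply, sub_sub_cancel_left, abs_neg, Int.abs_eq_natAbs]
  exact_mod_cast this

theorem pow (hB : HasRange ρ B) (m : ℕ) : ∃ σ, HasRange σ (B ^ m) := by
  induction m with
  | zero => exact ⟨0, by rw [pow_zero]; exact one⟩
  | succ m ih =>
    obtain ⟨σ, hσ⟩ := ih
    exact ⟨_, by rw [pow_succ]; exact hσ.mul hB⟩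

theorem sum {ι : Type*} (s : Finset ι) {B : ι → EllTwo d →L[ℂ] EllTwo d}
    (h : ∀ i, ∃ ρ, HasRange ρ (B i)) : ∃ ρ, HasRange ρ (∑ i ∈ s, B i) := by
  classical
  induction s using Finset.induction_on with
  | empty => exact ⟨0, zero⟩
  | insert i s hi ih =>
    rw [Finset.sum_insert hi]
    obtain ⟨ρ, hρ⟩ := h i
    obtain ⟨σ, hσ⟩ := ih
    exact ⟨_, hρ.add hσ⟩

theorem rep (n : ℕ) (c : LaurentRing d) : ∃ ρ, HasRange ρ (LaurentRing.rep n c) := by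
  induction c using AddMonoidAlgebra.induction_linear with
  | zero => exact ⟨0, by rw [map_zero]; exact zero⟩
  | add c₁ c₂ h₁ h₂ =>
    obtain ⟨ρ, hρ⟩ := h₁
    obtain ⟨σ, hσ⟩ := h₂
    exact ⟨_, by rw [map_add]; exact hρ.add hσ⟩
  | single v a =>
    obtain ⟨ρ, hρ⟩ := shift ((n : ℤ) • v)
    exact ⟨ρ, by rw [LaurentRing.rep_single]; exact hρ.smul a⟩

theorem evalOp {n : ℕ} (hp : IsPeriodicOp n B) (hB : HasRange ρ B) (p : (LaurentRing d)[X]) :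
    ∃ σ, HasRange σ (LaurentRing.evalOp hp p) := by
  rw [LaurentRing.evalOp_eq_sum]
  refine sum _ fun j => ?_
  obtain ⟨σ, hσ⟩ := rep n (p.coeff j)
  obtain ⟨τ, hτ⟩ := hB.pow j
  exact ⟨_, hσ.mul hτ⟩

theorem finite_support (hB : HasRange ρ B) {u : EllTwo d} (hu : (Function.support u).Finite) :
    (Function.support (B u)).Finite := by
  refine (hu.biUnion fun x _ =>
    (Finset.Icc (fun j => x j - (ρ : ℤ)) (fun j => x j + (ρ : ℤ))).finite_toSet).subset ?_
  intro y hy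
  by_contra h
  refine hy (hB u y fun x hx => ?_)
  by_contra hux
  refine h (Set.mem_biUnion hux ?_)
  rw [Finset.mem_coe, Finset.mem_Icc]
  constructor <;> intro j <;> have := abs_le.1 (hx j) <;> simp only <;> omega

end HasRange

end EllTwo

/-! ### Time averages of the Heisenberg evolution. -/

namespace JacobiCoeff

open EllTwo

variable {d : ℕ} {A : JacobiCoeff d}

theorem hasRange_op (A : JacobiCoeff d) : HasRange 1 A.op := fun u y hu => by
  rw [op_apply, hu y (by simp), mul_zero, add_zero]
  refine Finset.sum_eq_zero fun x hx => ?_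
  have h : Nbr y x := mem_nbrs.1 hx
  rw [hu x fun j => ?_, mul_zero]
  rw [abs_sub_comm]
  exact (Finset.single_le_sum (f := fun j => |y j - x j|) (fun i _ => abs_nonneg _)
      (Finset.mem_univ j)).trans h.le

/-- `B'` is the strong limit of the time averages of the Heisenberg evolution of `B`. -/
def HasTimeAverage (A : JacobiCoeff d) (B B' : EllTwo d →L[ℂ] EllTwo d) : Prop :=
  ∃ g : ℝ → EllTwo d →L[ℂ] EllTwo d, g 0 = 0 ∧
    (∀ t, HasDerivAt g (A.evol t * B * A.evol (-t)) t) ∧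
    ∀ u, Tendsto (fun t : ℝ => (t : ℂ)⁻¹ • g t u) atTop (𝓝 (B' u))

namespace HasTimeAverage

variable {B B' C C' : EllTwo d →L[ℂ] EllTwo d}

theorem add (h : A.HasTimeAverage B B') (h' : A.HasTimeAverage C C') :
    A.HasTimeAverage (B + C) (B' + C') := by
  obtain ⟨g, hg0, hg, hl⟩ := h
  obtain ⟨f, hf0, hf, hm⟩ := h'
  refine ⟨fun t => g t + f t, by simp [hg0, hf0], fun t => ?_, fun u => ?_⟩
  · exact ((hg t).add (hf t)).congr_deriv (by rw [mul_add, add_mul])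
  · simpa using (hl u).add (hm u)

theorem mul_left (hC : Commute C A.op) (h : A.HasTimeAverage B B') :
    A.HasTimeAverage (C * B) (C * B') := by
  obtain ⟨g, hg0, hg, hl⟩ := h
  refine ⟨fun t => C * g t, by simp [hg0], fun t => ?_, fun u => ?_⟩
  · refine ((hg t).const_mul C).congr_deriv ?_
    rw [← mul_assoc, ← mul_assoc, ← mul_assoc, (A.evol_commute hC t).eq]
  · refine ((C.continuous.tendsto _).comp (hl u)).congr fun t => ?_
    simp

theorem mul_right (hC : Commute C A.op) (h : A.HasTimeAverage B B') :
    A.HasTimeAverage (B * C) (B' * C) := by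
  obtain ⟨g, hg0, hg, hl⟩ := h
  refine ⟨fun t => g t * C, by simp [hg0], fun t => ?_, fun u => hl (C u)⟩
  refine ((hg t).mul_const C).congr_deriv ?_
  simp only [mul_assoc, (A.evol_commute hC (-t)).eq]

theorem of_commute (hC : Commute C A.op) : A.HasTimeAverage C C := by
  refine ⟨fun t => t • C, by simp, fun t => ?_, fun u => ?_⟩
  · refine ((hasDerivAt_id t).smul_const C).congr_deriv ?_
    rw [one_smul, ← (A.evol_commute hC t).eq, mul_assoc, evol_mul_neg, mul_one]
  · refine tendsto_const_nhds.congr' ?_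
    filter_upwards [eventually_ne_atTop (0 : ℝ)] with t ht
    change C u = (t : ℂ)⁻¹ • ((t : ℂ) • C u)
    rw [smul_smul, inv_mul_cancel₀ (by exact_mod_cast ht), one_smul]

theorem eq_zero (h : A.HasTimeAverage 0 B') : B' = 0 := by
  obtain ⟨g, hg0, hg, hl⟩ := h
  have h1 : ∀ t, g t = 0 := fun t => by
    rw [← hg0]
    refine is_const_of_deriv_eq_zero (fun t => (hg t).differentiableAt) (fun t => ?_) t 0
    rw [(hg t).deriv, mul_zero, zero_mul]
  ext1 u
  refine tendsto_nhds_unique (hl u) ?_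
  simp [h1]

/-- With `τ_t` the evolved operator, `[J, g(t)] = -i(τ_t - B)` stays bounded by `2‖B‖`, so it
vanishes in the limit after division by `t`. -/
theorem commute_op (h : A.HasTimeAverage B B') : Commute B' A.op := by
  obtain ⟨g, hg0, hg, hl⟩ := h
  let τ : ℝ → EllTwo d →L[ℂ] EllTwo d := fun t => A.evol t * B * A.evol (-t)
  have hτ : ∀ t, HasDerivAt τ (Complex.I • (A.op * τ t - τ t * A.op)) t := fun t => by
    have h1 : HasDerivAt (fun t => A.evol (-t)) _ t :=
      (A.hasDerivAt_evol (-t)).scomp t (hasDerivAt_neg t)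
    refine (((A.hasDerivAt_evol t).mul_const B).mul h1).congr_deriv ?_
    simp only [τ, neg_smul, one_smul, mul_neg, smul_mul_assoc, mul_smul_comm, mul_assoc, smul_add,
      smul_neg, (A.evol_commute (Commute.refl _) (-t)).eq, sub_eq_add_neg]
  have hconst : ∀ t, A.op * g t - g t * A.op + Complex.I • τ t = Complex.I • B := fun t => by
    have hF : ∀ t, HasDerivAt (fun t => A.op * g t - g t * A.op + Complex.I • τ t) 0 t := by
      intro t
      refine ((((hg t).const_mul A.op).sub ((hg t).mul_const A.op)).add
        ((hτ t).const_smul Complex.I)).congr_deriv ?_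
      rw [smul_smul, Complex.I_mul_I, neg_smul, one_smul]
      exact add_neg_cancel _
    have h2 := is_const_of_deriv_eq_zero (fun t => (hF t).differentiableAt)
      (fun t => (hF t).deriv) t 0
    simpa [hg0, τ, evol_zero] using h2
  have hbound : ∀ t, ‖A.op * g t - g t * A.op‖ ≤ 2 * ‖B‖ := fun t => by
    rw [eq_sub_of_add_eq (hconst t), ← smul_sub, norm_smul, Complex.norm_I, one_mul]
    refine (norm_sub_le _ _).trans ?_
    linarith [A.norm_conj_le t B]
  change B' * A.op = A.op * B'
  refine (sub_eq_zero.1 ?_).symm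
  ext1 u
  have h1 : Tendsto (fun t : ℝ => (t : ℂ)⁻¹ • (A.op * g t - g t * A.op) u) atTop
      (𝓝 ((A.op * B' - B' * A.op) u)) := by
    refine (((A.op.continuous.tendsto _).comp (hl u)).sub (hl (A.op u))).congr fun t => ?_
    simp [smul_sub]
  refine tendsto_nhds_unique h1 ?_
  have h2 : Tendsto (fun t : ℝ => t⁻¹ * (2 * ‖B‖ * ‖u‖)) atTop (𝓝 0) := by
    simpa using tendsto_inv_atTop_zero.mul_const (2 * ‖B‖ * ‖u‖)
  rw [zero_apply]
  refine squeeze_zero_norm' ?_ h2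
  filter_upwards [eventually_gt_atTop (0 : ℝ)] with t ht
  rw [norm_smul, norm_inv, Complex.norm_real, Real.norm_eq_abs, abs_of_pos ht]
  gcongr
  exact ContinuousLinearMap.le_of_opNorm_le _ (hbound t) u

end HasTimeAverage

open LaurentRing

variable {n : ℕ} (hA : IsPeriodicOp n A.op)

/-- The time average of `[X_k, p(J)]` is `n (z_k ∂_k p)(J) + p'(J) V`, if `V` is the time average of
`[X_k, J]`. -/
theorem exists_posComm_evalOp {k : Fin d} {K V : EllTwo d →L[ℂ] EllTwo d}
    (hK : PosComm k A.op K) (hV : A.HasTimeAverage K V) (p : (LaurentRing d)[X]) :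
    ∃ D, PosComm k (evalOp hA p) D ∧ A.HasTimeAverage D
      ((n : ℂ) • evalOp hA (polyLogDeriv k p) + evalOp hA (derivative p) * V) := by
  have hcomm : ∀ p, Commute (evalOp hA p) A.op := commute_evalOp hA hA (Commute.refl _)
  induction p using Polynomial.induction_on with
  | C a =>
    refine ⟨(n : ℂ) • rep n (logDeriv k a), ?_, ?_⟩
    · rw [evalOp_C]
      exact posComm_rep n k a
    · rw [polyLogDeriv_C, evalOp_C, derivative_C, map_zero, zero_mul, add_zero]
      exact HasTimeAverage.of_commute ((rep_commute hA _).smul_left _)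
  | add p q hp hq =>
    obtain ⟨D, hD, hD'⟩ := hp
    obtain ⟨E, hE, hE'⟩ := hq
    refine ⟨D + E, by rw [map_add]; exact hD.add hE, ?_⟩
    convert hD'.add hE' using 1
    simp only [map_add, smul_add, add_mul]
    abel
  | monomial m a h =>
    rw [pow_succ, ← mul_assoc]
    generalize C a * X ^ m = p at h ⊢
    obtain ⟨D, hD, hD'⟩ := h
    refine ⟨evalOp hA p * K + D * A.op, ?_, ?_⟩
    · rw [map_mul, evalOp_X]
      exact hD.mul hK
    -- Since `V` commutes with `J`, the average of `D J` can be rearranged with `V` on the right,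
    -- and the product rule for `p X` results.
    · convert (hV.mul_left (hcomm p)).add (hD'.mul_right (Commute.refl A.op)) using 1
      have e : polyLogDeriv k (p * X) = polyLogDeriv k p * X := by
        rw [Derivation.leibniz, polyLogDeriv_X, smul_zero, zero_add, smul_eq_mul, mul_comm]
      rw [e, derivative_mul, derivative_X, mul_one, map_add, map_mul, map_mul, evalOp_X, add_mul,
        add_mul, mul_assoc _ V, hV.commute_op.eq, smul_mul_assoc, mul_assoc _ A.op]
      abel

/-- As `p(J) = 0` has zero commutator with `X_k`, its averaged form `n (Dp)(J) + p'(J) V` vanishes;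
the second term dies on `ker V`. -/
theorem evalOp_polyLogDeriv_apply_eq_zero (hn : 0 < n) {k : Fin d}
    {K V : EllTwo d →L[ℂ] EllTwo d} (hK : PosComm k A.op K) (hV : A.HasTimeAverage K V)
    {p : (LaurentRing d)[X]} (hp : evalOp hA p = 0) {u : EllTwo d} (hu : V u = 0) :
    evalOp hA (polyLogDeriv k p) u = 0 := by
  obtain ⟨D, hD, hD'⟩ := exists_posComm_evalOp hA hK hV p
  rw [hp] at hD
  rw [hD.unique PosComm.zero] at hD'
  have h := congrArg (fun T : EllTwo d →L[ℂ] EllTwo d => T u) hD'.eq_zero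
  have hn' : (n : ℂ) ≠ 0 := by exact_mod_cast hn.ne'
  simpa [hu, hn'] using h

end JacobiCoeff

end

/-! ### Topmost points of supports. -/

noncomputable section

open Polynomial

/-- The lexicographic order on `ℤ^d` in which the `k`-th coordinate is compared first. -/
abbrev LexKey (d : ℕ) : Type := ℤ ×ₗ Lex (Fin d → ℤ)

namespace EllTwo

variable {d : ℕ}

/-- The key by which the points of `ℤ^d` are compared. -/
def lexKey (k : Fin d) (x : Fin d → ℤ) : LexKey d := toLex (x k, toLex x)

theorem lexKey_add (k : Fin d) (x y : Fin d → ℤ) :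
    lexKey k (x + y) = lexKey k x + lexKey k y := rfl

theorem lexKey_injective (k : Fin d) : Function.Injective (lexKey k) := fun x y h => by
  have h1 := congrArg (fun z => ofLex (ofLex z).2) h
  exact h1

theorem apply_le_of_lexKey_le {k : Fin d} {x y : Fin d → ℤ} (h : lexKey k x ≤ lexKey k y) :
    x k ≤ y k := by
  rcases Prod.Lex.le_iff.1 h with h1 | h1
  · exact h1.le
  · exact h1.1.le

theorem lexKey_lt_of_apply_lt {k : Fin d} {x y : Fin d → ℤ} (h : x k < y k) :
    lexKey k x < lexKey k y := by
  rw [← not_le]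
  exact fun h' => (apply_le_of_lexKey_le h').not_gt h

/-- The point `x` is the largest one at which `f` does not vanish. -/
def IsTop (k : Fin d) (f : (Fin d → ℤ) → ℂ) (x : Fin d → ℤ) : Prop :=
  f x ≠ 0 ∧ ∀ y, f y ≠ 0 → lexKey k y ≤ lexKey k x

theorem IsTop.eq_zero {k : Fin d} {f : (Fin d → ℤ) → ℂ} {x y : Fin d → ℤ} (h : IsTop k f x)
    (hy : lexKey k x < lexKey k y) : f y = 0 := by
  by_contra hf
  exact (h.2 y hf).not_gt hy

theorem exists_isTop (k : Fin d) {f : (Fin d → ℤ) → ℂ} (hf : (Function.support f).Finite)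
    (h0 : ∃ x, f x ≠ 0) : ∃ x, IsTop k f x := by
  obtain ⟨x, hx, hmax⟩ := Set.exists_max_image _ (lexKey k) hf h0
  exact ⟨x, hx, fun y hy => hmax y hy⟩

/-- In an ordered group, bounds on two summands that are attained by the sum are attained by each.
Only upper bounds are assumed, because a logarithmic derivative may vanish at the top exponent. -/
theorem coeff_mul_add_of_lexKey_le {k : Fin d} {c c' : LaurentRing d} {v v' : Fin d → ℤ}
    (h : ∀ w, c.coeff w ≠ 0 → lexKey k w ≤ lexKey k v)
    (h' : ∀ w, c'.coeff w ≠ 0 → lexKey k w ≤ lexKey k v') :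
    (c * c').coeff (v + v') = c.coeff v * c'.coeff v' := by
  refine AddMonoidAlgebra.coeff_mul_add_of_uniqueAdd fun w w' hw hw' e => ?_
  have h1 := h w (Finsupp.mem_support_iff.1 hw)
  have h2 := h' w' (Finsupp.mem_support_iff.1 hw')
  have e' : lexKey k w + lexKey k w' = lexKey k v + lexKey k v' := by
    rw [← lexKey_add, e, lexKey_add]
  obtain ⟨h3, h4⟩ := (add_eq_add_iff_eq_and_eq h1 h2).1 e'
  exact ⟨lexKey_injective k h3, lexKey_injective k h4⟩

theorem rep_apply (n : ℕ) (c : LaurentRing d) (u : EllTwo d) (y : Fin d → ℤ) :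
    LaurentRing.rep n c u y = ∑ v ∈ c.coeff.support, c.coeff v * u (y - (n : ℤ) • v) := by
  rw [LaurentRing.rep, AddMonoidAlgebra.lift_apply, Finsupp.sum, sum_apply, lp.coeFn_sum,
    Finset.sum_apply]
  rfl

theorem lexKey_smul_le {k : Fin d} (n : ℕ) {v w : Fin d → ℤ} (h : lexKey k v ≤ lexKey k w) :
    lexKey k ((n : ℤ) • v) ≤ lexKey k ((n : ℤ) • w) := by
  have e : ∀ v, lexKey k ((n : ℤ) • v) = n • lexKey k v := fun v => by
    rw [natCast_zsmul]
    induction n with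
    | zero => rw [zero_smul, zero_smul]; rfl
    | succ m ih => rw [succ_nsmul, succ_nsmul, lexKey_add, ih]
  rw [e, e]
  exact nsmul_le_nsmul_right h n

/-- Tops add, as for leading monomials of a product: only the pair of tops contributes at the new
point. -/
theorem IsTop.rep {k : Fin d} {n : ℕ} (hn : 0 < n) {c : LaurentRing d} {v : Fin d → ℤ}
    (hc : IsTop k c.coeff v) {u : EllTwo d} {x : Fin d → ℤ} (hu : IsTop k u x) :
    IsTop k (LaurentRing.rep n c u) (x + (n : ℤ) • v) := by
  have hn' : (n : ℤ) ≠ 0 := by exact_mod_cast hn.ne'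
  constructor
  · rw [rep_apply, Finset.sum_eq_single v]
    · rw [add_sub_cancel_right]
      exact mul_ne_zero hc.1 hu.1
    · intro w hw hwv
      have h1 := hc.2 w (Finsupp.mem_support_iff.1 hw)
      have h2 : lexKey k w < lexKey k v := lt_of_le_of_ne h1 fun e => hwv (lexKey_injective k e)
      have h3 : lexKey k ((n : ℤ) • w) < lexKey k ((n : ℤ) • v) :=
        lt_of_le_of_ne (lexKey_smul_le n h1) fun e =>
          hwv (smul_right_injective _ hn' (lexKey_injective k e))
      rw [hu.eq_zero, mul_zero]
      rw [← add_lt_add_iff_right (lexKey k ((n : ℤ) • w)), ← lexKey_add, ← lexKey_add,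
        sub_add_cancel, lexKey_add, lexKey_add]
      exact add_lt_add_right h3 _
    · intro h
      exact absurd (Finsupp.notMem_support_iff.1 h) hc.1
  · intro y hy
    rw [rep_apply] at hy
    obtain ⟨w, hw, hy'⟩ := Finset.exists_ne_zero_of_sum_ne_zero hy
    have h1 := lexKey_smul_le n (hc.2 w (Finsupp.mem_support_iff.1 hw))
    have h2 := hu.2 _ (right_ne_zero_of_mul hy')
    rw [← sub_add_cancel y ((n : ℤ) • w), lexKey_add, lexKey_add]
    exact add_le_add h2 h1

theorem exists_isTop_coeff (k : Fin d) {c : LaurentRing d} (hc : c ≠ 0) :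
    ∃ v, IsTop k c.coeff v := by
  refine exists_isTop k c.coeff.hasFiniteSupport ?_
  by_contra! h
  exact hc (AddMonoidAlgebra.coeff_injective (Finsupp.ext h))

theorem exists_isTop_apply (k : Fin d) {u : EllTwo d} (hf : (Function.support u).Finite)
    (hu : u ≠ 0) : ∃ x, IsTop k u x := by
  refine exists_isTop k hf ?_
  by_contra! h
  exact hu (lp.ext (funext h))

theorem rep_apply_ne_zero (k : Fin d) {n : ℕ} (hn : 0 < n) {c : LaurentRing d} (hc : c ≠ 0)
    {u : EllTwo d} (hf : (Function.support u).Finite) (hu : u ≠ 0) :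
    LaurentRing.rep n c u ≠ 0 := by
  obtain ⟨v, hv⟩ := exists_isTop_coeff k hc
  obtain ⟨x, hx⟩ := exists_isTop_apply k hf hu
  intro h
  exact (hv.rep hn hx).1 (by rw [h]; rfl)

theorem nbr_apply_le {x y : Fin d → ℤ} (h : Nbr x y) (k : Fin d) :
    x k ≤ y k ∨ x = y + Pi.single k 1 := by
  by_cases hk : x k ≤ y k
  · exact Or.inl hk
  refine Or.inr (funext fun j => ?_)
  have h1 : |x k - y k| + ∑ i ∈ Finset.univ.erase k, |x i - y i| = 1 := by
    rw [Finset.add_sum_erase _ (fun i => |x i - y i|) (Finset.mem_univ k)]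
    exact h
  have h2 : 0 ≤ ∑ i ∈ Finset.univ.erase k, |x i - y i| := Finset.sum_nonneg fun _ _ => abs_nonneg _
  have h3 : |x k - y k| = x k - y k := abs_of_pos (by omega)
  rw [Pi.add_apply]
  by_cases hj : j = k
  · subst hj
    rw [Pi.single_eq_same]
    omega
  · rw [Pi.single_eq_of_ne hj, add_zero]
    have h4 := (Finset.sum_eq_zero_iff_of_nonneg fun i _ => abs_nonneg (x i - y i)).1
      (by omega : ∑ i ∈ Finset.univ.erase k, |x i - y i| = 0) j
      (Finset.mem_erase.2 ⟨hj, Finset.mem_univ j⟩)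
    exact sub_eq_zero.1 (abs_eq_zero.1 h4)

theorem nbr_add_single (x : Fin d → ℤ) (k : Fin d) : Nbr (x + Pi.single k 1) x := by
  rw [Nbr, Finset.sum_eq_single k]
  · simp
  · intro j _ hj
    simp [Pi.single_eq_of_ne hj]
  · simp

/-- The `k`-th coordinate is compared first, so only the hop by `e_k` from the top reaches the new
point. Its coefficient is nonzero because the hoppings do not vanish. -/
theorem IsTop.op (A : JacobiCoeff d) {k : Fin d} {u : EllTwo d} {x : Fin d → ℤ}
    (hu : IsTop k u x) : IsTop k (A.op u) (x + Pi.single k 1) := by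
  have hup : ∀ y : Fin d → ℤ, lexKey k y < lexKey k (y + Pi.single k 1) := fun y =>
    lexKey_lt_of_apply_lt (by simp)
  constructor
  · rw [JacobiCoeff.op_apply, hu.eq_zero (hup x), mul_zero, add_zero, Finset.sum_eq_single x]
    · exact mul_ne_zero (A.ne_zero _ _ (nbr_add_single x k)) hu.1
    · intro y hy hyx
      rw [hu.eq_zero, mul_zero]
      rcases nbr_apply_le (mem_nbrs.1 hy) k with h | h
      · refine lexKey_lt_of_apply_lt (lt_of_lt_of_le ?_ h)
        simp
      · exact absurd (add_right_cancel h).symm hyx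
    · intro h
      exact absurd (mem_nbrs.2 (nbr_add_single x k)) h
  · intro z hz
    rw [JacobiCoeff.op_apply] at hz
    by_cases hz' : u z = 0
    · rw [hz', mul_zero, add_zero] at hz
      obtain ⟨y, hy, hy'⟩ := Finset.exists_ne_zero_of_sum_ne_zero hz
      have h1 := hu.2 y (right_ne_zero_of_mul hy')
      rcases nbr_apply_le (mem_nbrs.1 hy) k with h | h
      · refine (lexKey_lt_of_apply_lt ?_).le
        have := apply_le_of_lexKey_le h1
        rw [Pi.add_apply, Pi.single_eq_same]
        omega
      · rw [h, lexKey_add, lexKey_add]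
        exact add_le_add_left h1 _
    · exact (hu.2 z hz').trans (hup x).le

theorem IsTop.op_pow (A : JacobiCoeff d) {k : Fin d} {u : EllTwo d} {x : Fin d → ℤ}
    (hu : IsTop k u x) (m : ℕ) : IsTop k ((A.op ^ m) u) (x + m • Pi.single k 1) := by
  induction m with
  | zero => simpa using hu
  | succ m ih =>
    rw [pow_succ', mul_apply_eq_comp, succ_nsmul, ← add_assoc]
    exact ih.op A

end EllTwo

/-! ### Annihilating polynomials of `J`. -/

namespace LaurentRing

open EllTwo

variable {d : ℕ} {A : JacobiCoeff d} {n : ℕ} (hA : IsPeriodicOp n A.op)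

/-- A polynomial in `J` whose coefficients have constant ratios in the direction `k` is injective
on finitely supported functions. -/
theorem evalOp_apply_ne_zero_of_polyLogDeriv (hn : 0 < n) (k : Fin d) {p : (LaurentRing d)[X]}
    (hp : p ≠ 0)
    (h : C p.leadingCoeff * polyLogDeriv k p = C (logDeriv k p.leadingCoeff) * p)
    {u : EllTwo d} (hf : (Function.support u).Finite) (hu : u ≠ 0) : evalOp hA p u ≠ 0 := by
  obtain ⟨x, hx⟩ := exists_isTop_apply k hf hu
  have htop : ∀ j ∈ p.support, ∃ v, IsTop k (p.coeff j).coeff v := fun j hj =>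
    exists_isTop_coeff k (mem_support_iff.1 hj)
  have hm : p.natDegree ∈ p.support := natDegree_mem_support_of_nonzero hp
  obtain ⟨v, hv⟩ := htop _ hm
  -- The hypothesis makes `D` kill the ratios of coefficients to the leading one. Comparing the
  -- coefficients at the sum of the two tops gives `w_k = v_k`.
  have hdeg : ∀ j ∈ p.support, ∀ w, IsTop k (p.coeff j).coeff w → w k = v k := by
    intro j _ w hw
    have h1 := congrArg (fun q => (q.coeff j).coeff (v + w)) h
    simp only [coeff_C_mul, coeff_polyLogDeriv] at h1
    have hv : IsTop k p.leadingCoeff.coeff v := hv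
    have hv' : ∀ y, (logDeriv k p.leadingCoeff).coeff y ≠ 0 → lexKey k y ≤ lexKey k v :=
      fun y hy => hv.2 y (right_ne_zero_of_mul (coeff_logDeriv k _ y ▸ hy))
    have hw' : ∀ y, (logDeriv k (p.coeff j)).coeff y ≠ 0 → lexKey k y ≤ lexKey k w :=
      fun y hy => hw.2 y (right_ne_zero_of_mul (coeff_logDeriv k _ y ▸ hy))
    rw [coeff_mul_add_of_lexKey_le hv.2 hw', coeff_mul_add_of_lexKey_le hv' hw.2,
      coeff_logDeriv, coeff_logDeriv] at h1
    have h2 : ((w k : ℤ) : ℂ) = (v k : ℤ) := by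
      refine mul_right_cancel₀ (mul_ne_zero hv.1 hw.1) ?_
      linear_combination h1
    exact_mod_cast h2
  intro h0
  -- The `j`-th term has its top at height `x_k + j + n v_k`, so lower powers of `J` do not reach
  -- the top of the highest one.
  have h1 : ∀ j ∈ p.support, j ≠ p.natDegree →
      (rep n (p.coeff j) * A.op ^ j) u
        (x + p.natDegree • Pi.single k 1 + (n : ℤ) • v) = 0 := by
    intro j hj hjm
    obtain ⟨w, hw⟩ := htop j hj
    rw [mul_apply_eq_comp]
    refine (hw.rep hn (hx.op_pow A j)).eq_zero (lexKey_lt_of_apply_lt ?_)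
    have hlt : j < p.natDegree := lt_of_le_of_ne (le_natDegree_of_mem_supp j hj) hjm
    simp only [Pi.add_apply, Pi.smul_apply, nsmul_eq_mul, smul_eq_mul, hdeg j hj w hw]
    have : (j : ℤ) < p.natDegree := by exact_mod_cast hlt
    simpa using this
  have h2 := congrArg (fun w : EllTwo d => w (x + p.natDegree • Pi.single k 1 + (n : ℤ) • v)) h0
  simp only at h2
  rw [evalOp_eq_sum, sum_apply, lp.coeFn_sum, Finset.sum_apply,
    Finset.sum_eq_single_of_mem _ hm h1] at h2
  exact (hv.rep hn (hx.op_pow A p.natDegree)).1 h2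

theorem delta_mem_span_cell (hn : 0 < n) {u : EllTwo d} (hf : (Function.support u).Finite) :
    ∃ c : Cell n d → LaurentRing d, u = ∑ x, rep n (c x) (delta x.1) := by
  classical
  refine ⟨fun x => ∑ y ∈ hf.toFinset, if cellRep n hn y = x then
    AddMonoidAlgebra.single (fun j => y j / (n : ℤ)) (u y) else 0, ?_⟩
  have hu : u = ∑ y ∈ hf.toFinset, (u y : ℂ) • delta y :=
    (hasSum_delta u).unique (hasSum_sum_of_ne_finset_zero fun y hy => by
      rw [Set.Finite.mem_toFinset, Function.notMem_support] at hy
      rw [hy, zero_smul])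
  conv_lhs => rw [hu]
  simp only [map_sum, sum_apply]
  rw [Finset.sum_comm]
  refine Finset.sum_congr rfl fun y _ => ?_
  rw [Finset.sum_eq_single (cellRep n hn y)]
  · rw [if_pos rfl, rep_single, smul_apply, shift_delta, cellRep_add]
  · intro x _ hx
    rw [if_neg hx.symm, map_zero, zero_apply]
  · simp

/-- Cayley–Hamilton for a periodic operator of finite range. -/
theorem exists_monic_evalOp_eq_zero (hn : 0 < n) {B : EllTwo d →L[ℂ] EllTwo d}
    (hB : IsPeriodicOp n B) {ρ : ℕ} (hρ : HasRange ρ B) :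
    ∃ p : (LaurentRing d)[X], p.Monic ∧ evalOp hB p = 0 := by
  let _ : Module (LaurentRing d) (EllTwo d) :=
    Module.compHom (EllTwo d) (rep n : LaurentRing d →ₐ[ℂ] EllTwo d →L[ℂ] EllTwo d).toRingHom
  have hsmul : ∀ (c : LaurentRing d) (u : EllTwo d), c • u = rep n c u := fun _ _ => rfl
  let f : EllTwo d →ₗ[LaurentRing d] EllTwo d :=
    { toFun := B
      map_add' := B.map_add
      map_smul' := fun c u => by
        rw [hsmul, RingHom.id_apply, hsmul, ← mul_apply_eq_comp, ← (rep_commute hB c).eq,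
          mul_apply_eq_comp] }
  -- This finitely generated module contains all finitely supported functions and is stable under
  -- `B`. Cayley–Hamilton there annihilates every basis vector.
  let S : Submodule (LaurentRing d) (EllTwo d) :=
    Submodule.span (LaurentRing d) (Set.range fun x : Cell n d => delta x.1)
  have hmem : ∀ u : EllTwo d, (Function.support u).Finite → u ∈ S := fun u hf => by
    obtain ⟨c, hc⟩ := delta_mem_span_cell hn hf
    rw [hc]
    exact S.sum_mem fun x _ => S.smul_mem (c x) (Submodule.subset_span ⟨x, rfl⟩)
  have hdelta : ∀ x : Fin d → ℤ, (Function.support (delta x)).Finite := fun x => by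
    refine (Set.finite_singleton x).subset fun y hy => ?_
    by_contra h
    exact hy ((delta_apply x y).trans (if_neg h))
  have hfS : ∀ u ∈ S, f u ∈ S := fun u hu => by
    have h : S ≤ S.comap f := Submodule.span_le.2 (by
      rintro _ ⟨x, rfl⟩
      exact hmem _ (hρ.finite_support (hdelta x.1)))
    exact h hu
  have : Module.Finite (LaurentRing d) S := Module.Finite.span_of_finite _ (Set.finite_range _)
  obtain ⟨p, hp, hp0⟩ := LinearMap.exists_monic_and_aeval_eq_zero (LaurentRing d) (f.restrict hfS)
  refine ⟨p, hp, clm_ext fun x => ?_⟩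
  have hpow : ∀ (m : ℕ) (u : S), (((f.restrict hfS) ^ m) u).1 = (B ^ m) u.1 := by
    intro m
    induction m with
    | zero => intro u; rfl
    | succ m ih => intro u; rw [pow_succ, pow_succ, Module.End.mul_apply, ih]; rfl
  have h := congrArg (fun g : Module.End (LaurentRing d) S =>
    (g ⟨delta x, hmem _ (hdelta x)⟩).1) hp0
  simp only [aeval_eq_sum_range, LinearMap.sum_apply, LinearMap.smul_apply,
    AddSubmonoidClass.coe_finsetSum, SetLike.val_smul, hpow, hsmul, LinearMap.zero_apply,
    ZeroMemClass.coe_zero] at h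
  rw [zero_apply, ← h]
  change (eval₂ (rep n).toRingHom B p) (delta x) = _
  rw [eval₂_eq_sum_range, sum_apply]
  rfl

/-- Over a domain, each division step becomes possible after multiplying by the leading coefficient
of `p`. -/
theorem exists_pseudo_division {R : Type*} [CommRing R] [IsDomain R] {p : R[X]} (hp : p ≠ 0)
    (q : R[X]) : ∃ c : R, c ≠ 0 ∧ ∃ g s, C c * q = p * g + s ∧ s.degree < p.degree := by
  induction q using degree_lt_wf.induction with
  | _ q ih =>
  by_cases hq : q.degree < p.degree
  · exact ⟨1, one_ne_zero, 0, q, by simp, hq⟩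
  have hle : p.degree ≤ q.degree := not_lt.1 hq
  have hq0 : q ≠ 0 := by
    rintro rfl
    rw [degree_zero, le_bot_iff, degree_eq_bot] at hle
    exact hp hle
  have hp' : p.leadingCoeff ≠ 0 := leadingCoeff_ne_zero.2 hp
  have hq' : q.leadingCoeff ≠ 0 := leadingCoeff_ne_zero.2 hq0
  set t : R[X] := C q.leadingCoeff * X ^ (q.natDegree - p.natDegree) with ht
  have hd1 : (C p.leadingCoeff * q).degree = q.degree := degree_C_mul hp'
  have hd2 : (t * p).degree = q.degree := by
    rw [degree_mul, ht, degree_C_mul_X_pow _ hq', degree_eq_natDegree hp, degree_eq_natDegree hq0]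
    have := natDegree_le_natDegree hle
    norm_cast
    omega
  have hlt : (C p.leadingCoeff * q - t * p).degree < q.degree := by
    have h := degree_sub_lt_left (hd1.trans hd2.symm) (mul_ne_zero (C_ne_zero.2 hp') hq0) (by
      rw [ht, leadingCoeff_mul, leadingCoeff_mul, leadingCoeff_C, leadingCoeff_C_mul_X_pow,
        mul_comm])
    rwa [hd1] at h
  obtain ⟨c, hc, g, s, h, hs⟩ := ih _ hlt
  refine ⟨c * p.leadingCoeff, mul_ne_zero hc hp', g + C c * t, s, ?_, hs⟩
  rw [C_mul]
  linear_combination h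

/-- If `r` is a nonzero annihilating polynomial of `J` of minimal degree, then `(z_k ∂_k r)(J)` is
injective on finitely supported functions. -/
theorem eq_zero_of_evalOp_polyLogDeriv (hn : 0 < n) (k : Fin d) {r : (LaurentRing d)[X]}
    (hr0 : r ≠ 0) (hr : evalOp hA r = 0)
    (hmin : ∀ q, q ≠ 0 → evalOp hA q = 0 → r.natDegree ≤ q.natDegree)
    {u : EllTwo d} (hf : (Function.support u).Finite) (hu : evalOp hA (polyLogDeriv k r) u = 0) :
    u = 0 := by
  classical
  by_contra hu0
  -- Minimize the degree of `p` over all pairs with `p(J)w = 0`, where `w ≠ 0` is finitely supported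
  -- and killed by `(Dr)(J)`; the vector varies too.
  let S : Set ℕ := {m | ∃ (u : EllTwo d) (p : (LaurentRing d)[X]), (Function.support u).Finite ∧
    u ≠ 0 ∧ evalOp hA (polyLogDeriv k r) u = 0 ∧ p ≠ 0 ∧ evalOp hA p u = 0 ∧ p.natDegree = m}
  have hS : ∃ m, m ∈ S := ⟨_, u, r, hf, hu0, hu, hr0, by rw [hr, zero_apply], rfl⟩
  obtain ⟨w, p, hwf, hw0, hw, hp0, hpw, hpm⟩ := Nat.find_spec hS
  have hSmin : ∀ (w' : EllTwo d) (q : (LaurentRing d)[X]), (Function.support w').Finite →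
      w' ≠ 0 → evalOp hA (polyLogDeriv k r) w' = 0 → evalOp hA q w' = 0 → q.degree < p.degree →
      q = 0 := by
    intro w' q h1 h2 h3 h4 h5
    by_contra hq
    have h6 := Nat.find_min' hS ⟨w', q, h1, h2, h3, hq, h4, rfl⟩
    have h7 := natDegree_lt_natDegree hq h5
    omega
  have hmul : ∀ (a b : (LaurentRing d)[X]) (v : EllTwo d), evalOp hA b v = 0 →
      evalOp hA (a * b) v = 0 := fun a b v h => by
    rw [map_mul, mul_apply_eq_comp, h, map_zero]
  have hdvd : ∀ q, evalOp hA q w = 0 → ∃ c : LaurentRing d, c ≠ 0 ∧ ∃ g, C c * q = p * g := by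
    intro q hq
    obtain ⟨c, hc, g, s, h, hs⟩ := exists_pseudo_division hp0 q
    refine ⟨c, hc, g, ?_⟩
    rw [h, hSmin w s hwf hw0 hw ?_ hs, add_zero]
    rw [eq_sub_of_add_eq' h.symm, map_sub, sub_apply, hmul _ _ _ hq, mul_comm p,
      hmul _ _ _ hpw, sub_zero]
  have hrw : evalOp hA r w = 0 := by rw [hr, zero_apply]
  obtain ⟨c, hc, g, hg⟩ := hdvd r hrw
  -- If `g(J)w = 0`, then `p²` divides `r` up to a nonzero constant. Reducedness lets `p g'`
  -- annihilate `J`, and minimality of `r` forces `deg p = 0`. A nonzero constant, however, is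
  -- injective on finite supports.
  by_cases hgw : evalOp hA g w = 0
  · obtain ⟨c', hc', g', hg'⟩ := hdvd g hgw
    have e : C (c' * c) * r = p * p * g' := by
      rw [C_mul]
      linear_combination C c' * hg + p * hg'
    have hne : p * p * g' ≠ 0 := by
      rw [← e]
      exact mul_ne_zero (C_ne_zero.2 (mul_ne_zero hc' hc)) hr0
    have hg'0 : g' ≠ 0 := right_ne_zero_of_mul hne
    have hsq : evalOp hA (p * g') = 0 := by
      refine evalOp_eq_zero_of_sq hA A.star_op ?_
      have e' : p * g' * (p * g') = g' * C (c' * c) * r := by linear_combination -g' * e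
      rw [e', map_mul, hr, mul_zero]
    have h1 := hmin _ (mul_ne_zero hp0 hg'0) hsq
    have h2 := congrArg natDegree e
    rw [natDegree_C_mul (mul_ne_zero hc' hc), natDegree_mul (mul_ne_zero hp0 hp0) hg'0,
      natDegree_mul hp0 hp0] at h2
    rw [natDegree_mul hp0 hg'0] at h1
    have h3 : p = C (p.coeff 0) := eq_C_of_natDegree_eq_zero (by omega)
    have h4 : p.coeff 0 ≠ 0 := fun h => hp0 (by rw [h3, h, C_0])
    rw [h3, evalOp_C] at hpw
    exact rep_apply_ne_zero k hn h4 hwf hw0 hpw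
  -- Otherwise `g(J)w` is a competitor. The leading terms of `s` cancel, and applying `D` to `c r =
  -- p g` shows that `s(J)` kills `g(J)w`. Minimality gives `s = 0`, the condition of constant
  -- ratios.
  · set s := C p.leadingCoeff * polyLogDeriv k p - C (logDeriv k p.leadingCoeff) * p with hs
    have hsdeg : s.degree < p.degree := by
      rw [degree_eq_natDegree hp0, degree_lt_iff_coeff_zero]
      intro m hm
      rw [hs, coeff_sub, coeff_C_mul, coeff_C_mul, coeff_polyLogDeriv]
      rcases hm.eq_or_lt with rfl | hm
      · rw [coeff_natDegree]
        ring
      · rw [coeff_eq_zero_of_natDegree_lt hm, map_zero, mul_zero, mul_zero, sub_zero]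
    have hsg : evalOp hA (s * g) w = 0 := by
      have h := congrArg (polyLogDeriv k) hg
      rw [Derivation.leibniz, Derivation.leibniz] at h
      simp only [smul_eq_mul] at h
      have e : s * g = C p.leadingCoeff * C c * polyLogDeriv k r +
          C p.leadingCoeff * polyLogDeriv k (C c) * r - (C p.leadingCoeff * polyLogDeriv k g +
            g * C (logDeriv k p.leadingCoeff)) * p := by
        linear_combination -C p.leadingCoeff * h
      rw [e, map_sub, map_add, sub_apply, add_apply, hmul _ _ _ hw, hmul _ _ _ hrw,
        hmul _ _ _ hpw, add_zero, sub_zero]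
    obtain ⟨ρ, hρ⟩ := HasRange.evalOp hA A.hasRange_op g
    have hcomp : ∀ q, evalOp hA (q * g) w = evalOp hA q (evalOp hA g w) := fun q => by
      rw [map_mul, mul_apply_eq_comp]
    have hs0 : s = 0 := hSmin _ s (hρ.finite_support hwf) hgw
      (by rw [← hcomp, mul_comm, hmul _ _ _ hw]) (by rw [← hcomp, hsg]) hsdeg
    exact evalOp_apply_ne_zero_of_polyLogDeriv hA hn k hp0 (sub_eq_zero.1 hs0) hwf hw0 hpw

/-- An annihilating polynomial `r` of `J` for which `(z_k ∂_k r)(J)` is injective. -/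
theorem exists_evalOp_eq_zero_injective (hn : 0 < n) (k : Fin d) :
    ∃ r : (LaurentRing d)[X], evalOp hA r = 0 ∧
      ∀ u, evalOp hA (polyLogDeriv k r) u = 0 → u = 0 := by
  classical
  have hex : ∃ m, ∃ r : (LaurentRing d)[X], r ≠ 0 ∧ evalOp hA r = 0 ∧ r.natDegree = m := by
    obtain ⟨r, hr, hr0⟩ := exists_monic_evalOp_eq_zero hn hA A.hasRange_op
    exact ⟨_, r, hr.ne_zero, hr0, rfl⟩
  obtain ⟨r, hr0, hr, hrm⟩ := Nat.find_spec hex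
  refine ⟨r, hr, fun u hu => ?_⟩
  obtain ⟨ρ, hρ⟩ := HasRange.evalOp hA A.hasRange_op (polyLogDeriv k r)
  refine injective_of_finite_support hn (isPeriodicOp_evalOp hA _) hρ (fun w hwf hw => ?_) hu
  exact eq_zero_of_evalOp_polyLogDeriv hA hn k hr0 hr
    (fun q hq hq0 => hrm ▸ Nat.find_min' hex ⟨q, hq, hq0, rfl⟩) hwf hw

end LaurentRing

end

/-! ### Domains, self-adjointness and conclusion. -/

noncomputable section

open Filter Topology

namespace JacobiCoeff

open EllTwo LaurentRing

variable {d : ℕ} {A : JacobiCoeff d} {k : Fin d} {G : ℝ → EllTwo d →L[ℂ] EllTwo d}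

/-- The bounded commutator makes `e^{-itJ}` preserve the domain for every `t`, and its inverse
belongs to the same group. -/
theorem evol_mem_domain_iff (hG : ∀ t, PosComm k (A.evol (-t)) (A.evol (-t) * G t)) (t : ℝ)
    (ψ : EllTwo d) : A.evol (-t) ψ ∈ (posOp k).domain ↔ ψ ∈ (posOp k).domain := by
  have h : ∀ s, ∀ φ ∈ (posOp k).domain, A.evol (-s) φ ∈ (posOp k).domain := fun s φ hφ =>
    mem_domain_of_posGraph (hG s _ _ (posOp_mem_posGraph ⟨φ, hφ⟩))
  refine ⟨fun hψ => ?_, h t ψ⟩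
  have h1 := h (-t) _ hψ
  rwa [← mul_apply_eq_comp, neg_neg, evol_mul_neg, one_apply_eq_self] at h1

theorem evol_posOp_evol (hG : ∀ t, PosComm k (A.evol (-t)) (A.evol (-t) * G t)) (t : ℝ)
    {ψ : EllTwo d} (hψ : ψ ∈ (posOp k).domain) (h : A.evol (-t) ψ ∈ (posOp k).domain) :
    A.evol t (posOp k ⟨A.evol (-t) ψ, h⟩) = posOp k ⟨ψ, hψ⟩ + G t ψ := by
  rw [posGraph_unique (posOp_mem_posGraph ⟨A.evol (-t) ψ, h⟩)
    (hG t _ _ (posOp_mem_posGraph ⟨ψ, hψ⟩)), mul_apply_eq_comp, ← map_add, ← mul_apply_eq_comp,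
    evol_mul_neg, one_apply_eq_self]

theorem isSelfAdjoint_of_tendsto (hG : ∀ t, star (G t) = G t) {Q : EllTwo d →L[ℂ] EllTwo d}
    (hQ : ∀ u, Tendsto (fun t : ℝ => (t : ℂ)⁻¹ • G t u) atTop (𝓝 (Q u))) : IsSelfAdjoint Q := by
  rw [ContinuousLinearMap.isSelfAdjoint_iff_isSymmetric]
  intro u w
  refine tendsto_nhds_unique ((hQ u).inner tendsto_const_nhds)
    ((tendsto_const_nhds.inner (hQ w)).congr fun t => ?_)
  rw [inner_smul_left, inner_smul_right, ← ContinuousLinearMap.adjoint_inner_left,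
    ← ContinuousLinearMap.star_eq_adjoint, hG, map_inv₀, Complex.conj_ofReal]

theorem exists_velocity (hA : A.IsPeriodic) (k : Fin d) :
    ∃ (G : ℝ → EllTwo d →L[ℂ] EllTwo d) (Q : EllTwo d →L[ℂ] EllTwo d),
      (∀ t, PosComm k (A.evol (-t)) (A.evol (-t) * G t)) ∧ IsSelfAdjoint Q ∧
      (∀ u, Tendsto (fun t : ℝ => (t : ℂ)⁻¹ • G t u) atTop (𝓝 (Q u))) ∧
      ∀ u, Q u = 0 → u = 0 := by
  obtain ⟨n, hn, hp⟩ := A.exists_period hA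
  obtain ⟨K, hK⟩ := A.exists_posComm_op k
  obtain ⟨G, hG0, hGd, hG⟩ := A.exists_displacement hK
  obtain ⟨Q, hQ⟩ := exists_asymptotic_velocity hn hp hG0 hG
    (continuous_iff_continuousAt.2 fun t => (hGd t).continuousAt)
  refine ⟨G, Q, hG, isSelfAdjoint_of_tendsto (star_displacement hG) hQ, hQ, fun u hu => ?_⟩
  -- `G` integrates `-i` times the evolution of `K`, so the factor `i` recovers the average of `K`
  -- itself.
  have havg : A.HasTimeAverage K (Complex.I • Q) := by
    refine ⟨fun t => Complex.I • G t, by simp [hG0], fun t => ?_, fun u => ?_⟩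
    · refine ((hGd t).const_smul Complex.I).congr_deriv ?_
      rw [mul_smul_comm, smul_mul_assoc, smul_smul, mul_neg, Complex.I_mul_I, neg_neg, one_smul]
    · refine ((hQ u).const_smul Complex.I).congr fun t => ?_
      rw [smul_apply, smul_comm]
  obtain ⟨r, hr, hinj⟩ := exists_evalOp_eq_zero_injective hp hn k
  refine hinj u (evalOp_polyLogDeriv_apply_eq_zero hp hn hK havg hr ?_)
  rw [smul_apply, hu, smul_zero]

theorem tendsto_add_displacement {Q : EllTwo d →L[ℂ] EllTwo d}
    (hQ : ∀ u, Tendsto (fun t : ℝ => (t : ℂ)⁻¹ • G t u) atTop (𝓝 (Q u))) (φ u : EllTwo d) :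
    Tendsto (fun t : ℝ => (t : ℂ)⁻¹ • (φ + G t u)) atTop (𝓝 (Q u)) := by
  have h : Tendsto (fun t : ℝ => ((t⁻¹ : ℝ) : ℂ)) atTop (𝓝 ((0 : ℝ) : ℂ)) :=
    (Complex.continuous_ofReal.tendsto _).comp tendsto_inv_atTop_zero
  simpa [smul_add] using (h.smul_const φ).add (hQ u)

end JacobiCoeff

end

theorem theorem1 (d : ℕ) (hd : 1 ≤ d) (A : JacobiCoeff d) (hA : A.IsPeriodic) :
    (∃ Q : Fin d → (EllTwo d →L[ℂ] EllTwo d), ∀ k,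
      IsSelfAdjoint (Q k) ∧
      StrongLim (fun t => (t : ℂ)⁻¹ • A.posOpAt k t) (posOp k).domain (Q k) ∧
      LinearMap.ker (Q k).toLinearMap = ⊥) ∧
    ∃ Q : EllTwo d →L[ℂ] EllTwoVec d,
      StrongLim (fun t => (t : ℂ)⁻¹ • A.vecPosOpAt t) (vecPosOp d).domain Q ∧
      LinearMap.ker Q.toLinearMap = ⊥ := by
  choose G Q hG hsa hQ hker using fun k => JacobiCoeff.exists_velocity hA k
  have hdom : ∀ k t, (posOp k).domain = (A.posOpAt k t).domain := fun k t =>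
    Submodule.ext fun ψ => (JacobiCoeff.evol_mem_domain_iff (hG k) t ψ).symm
  have hvdom : ∀ t, (vecPosOp d).domain = (A.vecPosOpAt t).domain := fun t =>
    Submodule.ext fun ψ => by
      change ψ ∈ ⨅ k, (posOp k).domain ↔ A.evol (-t) ψ ∈ ⨅ k, (posOp k).domain
      rw [Submodule.mem_iInf, Submodule.mem_iInf]
      exact forall_congr' fun k => (JacobiCoeff.evol_mem_domain_iff (hG k) t ψ).symm
  refine ⟨⟨Q, fun k => ⟨hsa k, ⟨hdom k, fun ψ => ?_⟩, ?_⟩⟩, ?_⟩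
  · refine (JacobiCoeff.tendsto_add_displacement (hQ k) (posOp k ψ) ψ.1).congr fun t => ?_
    exact congrArg ((t : ℂ)⁻¹ • ·) (JacobiCoeff.evol_posOp_evol (hG k) t ψ.2
      ((JacobiCoeff.evol_mem_domain_iff (hG k) t ψ.1).2 ψ.2)).symm
  · exact (LinearMap.ker_eq_bot').2 (hker k)
  · refine ⟨(PiLp.continuousLinearEquiv 2 ℂ (fun _ : Fin d => EllTwo d)).symm.toContinuousLinearMap
      ∘L ContinuousLinearMap.pi Q, ⟨hvdom, fun ψ => ?_⟩, ?_⟩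
    · have hψ : ∀ k, ψ.1 ∈ (posOp k).domain := (Submodule.mem_iInf _).1 ψ.2
      have h : Filter.Tendsto (fun t : ℝ => fun k =>
          (t : ℂ)⁻¹ • (posOp k ⟨ψ.1, hψ k⟩ + G k t ψ.1)) Filter.atTop (nhds fun k => Q k ψ.1) :=
        tendsto_pi_nhds.2 fun k => JacobiCoeff.tendsto_add_displacement (hQ k) _ _
      refine (((PiLp.continuousLinearEquiv 2 ℂ (fun _ : Fin d => EllTwo d)).symm.continuous.tendsto
        _).comp h).congr fun t => ?_
      ext k : 1
      exact congrArg ((t : ℂ)⁻¹ • ·) (JacobiCoeff.evol_posOp_evol (hG k) t (hψ k)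
        ((JacobiCoeff.evol_mem_domain_iff (hG k) t ψ.1).2 (hψ k))).symm
    -- One injective component suffices, and `d ≥ 1` provides one.
    · refine (LinearMap.ker_eq_bot').2 fun u hu => hker ⟨0, hd⟩ u ?_
      exact congrArg (fun Ψ : EllTwoVec d => Ψ ⟨0, hd⟩) hu
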